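/- Let $L$ be a locally compact (Hausdorff) group, $M$ a compact open subgroup of $L$, and $\mu$ the left Haar measure on $L$ normalised so that $\mu(M)=1$. Let $\sigma$ be an irreducible (continuous, unitary) representation of $M$ on a Hilbert space $V_\sigma$ (so $V_\sigma$ is finite-dimensional), let $d(\sigma)=\dim V_\sigma$, and let $\operatorname{Tr}$ be the unnormalised trace on $\mathcal B(V_\sigma)$. Let $C^*(L)$ be the (full) group $C^*$-algebra of $L$, let $\lambda$ be the universal unitary representation of $L$, with values in the unitary multipliers of $C^*(L)$, and put $$A=C^*(L)\otimes\mathcal B(V_\sigma),\qquad p_\sigma=\int_M\lambda(k)\otimes\sigma(k)\,d\mu(k),\qquad \psi_\sigma=\int_M d(\sigma)\operatorname{Tr}(\sigma(k))\,\lambda(k)\,d\mu(k),$$ so that $p_\sigma$ is a projection in $A$ and $\psi_\sigma$ is a projection in $C^*(L)$. Then the generalised Hecke $C^*$-algebra $p_\sigma A p_\sigma$ is Morita--Rieffel equivalent to the ideal $\overline{C^*(L)\psi_\sigma C^*(L)}$ of $C^*(L)$; that is, there is a $p_\sigma A p_\sigma$--$\overline{C^*(L)\psi_\sigma C^*(L)}$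 imprimitivity bimodule. Here $\overline{C^*(L)\psi_\sigma C^*(L)}$ denotes the closed linear span of the elements $a\psi_\sigma b$ with $a,b\in C^*(L)$. -/

import Mathlib

open MeasureTheory
open scoped TensorProduct CompactlySupported

universe u v w

set_option linter.unusedSectionVars false

/-! ### Unitary representations -/

/-- A continuous unitary representation of a topological group `G` on a complex Hilbert space `H`:
a homomorphism into the unitary group of `H`, continuous for the strong operator topology. -/
structure UnitaryRep (G : Type*) [Group G] [TopologicalSpace G]
    (H : Type*) [NormedAddCommGroup H] [InnerProductSpace ℂ H] where
  toHom : G →* (H ≃ₗᵢ[ℂ] H)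
  continuous_apply : ∀ ξ : H, Continuous fun g : G => toHom g ξ

namespace UnitaryRep

section Basic

variable {G : Type*} [Group G] [TopologicalSpace G]
  {H : Type*} [NormedAddCommGroup H] [InnerProductSpace ℂ H]

/-- The unitary operator `π(g)`. -/
def op (π : UnitaryRep G H) (g : G) : H →L[ℂ] H :=
  (π.toHom g).toLinearIsometry.toContinuousLinearMap

theorem apply_apply_inv (π : UnitaryRep G H) (g : G) (ξ : H) :
    π.toHom g (π.toHom g⁻¹ ξ) = ξ := by
  have h := DFunLike.congr_fun (π.toHom.map_mul g g⁻¹) ξ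
  rw [mul_inv_cancel, map_one] at h
  exact h.symm

/-- `π` is irreducible: `H ≠ 0`, and the only closed invariant subspaces are `0` and `H`. -/
def Irreducible (π : UnitaryRep G H) : Prop :=
  Nontrivial H ∧ ∀ W : Submodule ℂ H, IsClosed (W : Set H) →
    (∀ g : G, ∀ ξ ∈ W, π.op g ξ ∈ W) → W = ⊥ ∨ W = ⊤

/-- The restriction of a unitary representation to an open subgroup. -/
def restrict (π : UnitaryRep G H) (M : OpenSubgroup G) : UnitaryRep M H where
  toHom := π.toHom.comp (M : Subgroup G).subtype
  continuous_apply ξ := (π.continuous_apply ξ).comp continuous_subtype_val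

/-- Strong continuity of a group of isometries may be checked on a total set of vectors. -/
theorem continuous_of_dense (U : G →* (H ≃ₗᵢ[ℂ] H)) (S : Set H)
    (hS : closure (Submodule.span ℂ S : Set H) = Set.univ)
    (hU : ∀ ξ ∈ S, Continuous fun g : G => U g ξ) (ξ : H) : Continuous fun g : G => U g ξ := by
  have hspan : ∀ η ∈ Submodule.span ℂ S, Continuous fun g : G => U g η := by
    intro η hη
    induction hη using Submodule.span_induction with
    | mem x hx => exact hU x hx
    | zero => simpa using continuous_const
    | add x y _ _ hx hy =>
      simp only [map_add]
      exact Continuous.add hx hy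
    | smul c x _ hx =>
      simp only [map_smul]
      exact Continuous.const_smul hx c
  rw [continuous_iff_continuousAt]
  intro g₀
  rw [Metric.continuousAt_iff']
  intro ε hε
  have hξ : ξ ∈ closure (Submodule.span ℂ S : Set H) := by rw [hS]; trivial
  obtain ⟨η, hη, hd⟩ := Metric.mem_closure_iff.1 hξ (ε / 3) (by positivity)
  have h1 := Metric.continuousAt_iff'.1 ((hspan η hη).continuousAt (x := g₀)) (ε / 3)
    (by positivity)
  filter_upwards [h1] with g hg
  have e1 : dist (U g ξ) (U g η) = dist ξ η := (U g).isometry.dist_eq _ _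
  have e2 : dist (U g₀ η) (U g₀ ξ) = dist ξ η := by
    rw [dist_comm ξ η]; exact (U g₀).isometry.dist_eq _ _
  have t1 := dist_triangle (U g ξ) (U g η) (U g₀ ξ)
  have t2 := dist_triangle (U g η) (U g₀ η) (U g₀ ξ)
  linarith

end Basic

/-! ### The integrated form of a representation -/

section Integrated

variable {G : Type*} [Group G] [TopologicalSpace G] [MeasurableSpace G] [BorelSpace G]
  {H : Type*} [NormedAddCommGroup H] [InnerProductSpace ℂ H]

theorem integrable_smul (π : UnitaryRep G H) (μ : Measure G) [IsFiniteMeasureOnCompacts μ]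
    (f : C_c(G, ℂ)) (ξ : H) : Integrable (fun g => f g • π.op g ξ) μ := by
  apply Continuous.integrable_of_hasCompactSupport
  · exact (map_continuous f).smul (π.continuous_apply ξ)
  · exact f.hasCompactSupport.smul_right

/-- The integrated form of `π`: the operator `π(f) = ∫ f(g) π(g) dμ(g)` (strong integral) for
`f ∈ C_c(G)`. -/
noncomputable def integrated (π : UnitaryRep G H) (μ : Measure G) [IsFiniteMeasureOnCompacts μ]
    (f : C_c(G, ℂ)) : H →L[ℂ] H :=
  LinearMap.mkContinuous
    { toFun := fun ξ => ∫ g, f g • π.op g ξ ∂μ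
      map_add' := fun ξ η => by
        rw [← integral_add (π.integrable_smul μ f ξ) (π.integrable_smul μ f η)]
        simp
      map_smul' := fun c ξ => by
        rw [RingHom.id_apply, ← integral_smul]
        simp [smul_comm c] }
    (∫ g, ‖f g‖ ∂μ) (fun ξ => by
      refine (norm_integral_le_integral_norm _).trans (le_of_eq ?_)
      rw [← integral_mul_const]
      refine integral_congr_ae (Filter.Eventually.of_forall fun g => ?_)
      simp [norm_smul, op])

theorem integrated_apply (π : UnitaryRep G H) (μ : Measure G) [IsFiniteMeasureOnCompacts μ]
    (f : C_c(G, ℂ)) (ξ : H) : π.integrated μ f ξ = ∫ g, f g • π.op g ξ ∂μ := rfl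

end Integrated

end UnitaryRep

/-! ### The universal representation and the group C*-algebra -/

/-- A unitary representation of `G` on some Hilbert space in the universe of `G`. Every cyclic
representation of `G` is unitarily equivalent to one of these. -/
structure BundledUnitaryRep (G : Type u) [Group G] [TopologicalSpace G] : Type (u + 1) where
  space : Type u
  [normed : NormedAddCommGroup space]
  [inner : InnerProductSpace ℂ space]
  [complete : CompleteSpace space]
  rep : UnitaryRep G space

attribute [instance] BundledUnitaryRep.normed BundledUnitaryRep.inner BundledUnitaryRep.complete

/-- The Hilbert sum of the spaces of all unitary representations of `G`. -/
abbrev UniversalSpace (G : Type u) [Group G] [TopologicalSpace G] : Type (u + 1) :=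
  lp (fun π : BundledUnitaryRep G => π.space) 2

/-- The Hilbert sum of a family of unitary operators. -/
noncomputable def lpUnitary {ι : Type*} {E : ι → Type*} [∀ i, NormedAddCommGroup (E i)]
    [∀ i, InnerProductSpace ℂ (E i)] (e : ∀ i, E i ≃ₗᵢ[ℂ] E i) : lp E 2 ≃ₗᵢ[ℂ] lp E 2 where
  toFun x := ⟨fun i => e i (x i), by
    have h := lp.memℓp x
    refine (memℓp_gen_iff (by simp)).2 ?_
    rw [memℓp_gen_iff (by simp)] at h
    simpa using h⟩
  invFun x := ⟨fun i => (e i).symm (x i), by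
    have h := lp.memℓp x
    refine (memℓp_gen_iff (by simp)).2 ?_
    rw [memℓp_gen_iff (by simp)] at h
    simpa using h⟩
  map_add' x y := by ext i; exact map_add (e i) (x i) (y i)
  map_smul' c x := by ext i; exact map_smul (e i) c (x i)
  left_inv x := by ext i; simp
  right_inv x := by ext i; simp
  norm_map' x := by
    have h : (0 : ℝ) < (2 : ENNReal).toReal := by simp
    rw [lp.norm_eq_tsum_rpow h, lp.norm_eq_tsum_rpow h]
    simp

/-- The universal representation of `G`: the direct sum of all its unitary representations. -/
noncomputable def universalRep (G : Type u) [Group G] [TopologicalSpace G] :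
    UnitaryRep G (UniversalSpace G) where
  toHom :=
    { toFun := fun g => lpUnitary fun π : BundledUnitaryRep G => π.rep.toHom g
      map_one' := by ext x i; simp [lpUnitary]
      map_mul' := fun g h => by ext x i; simp [lpUnitary] }
  continuous_apply := by
    classical
    apply UnitaryRep.continuous_of_dense _
      (Set.range fun p : (Σ π : BundledUnitaryRep G, π.space) =>
        (lp.single 2 p.1 p.2 : UniversalSpace G))
    · rw [Set.eq_univ_iff_forall]
      intro x
      refine mem_closure_of_tendsto (lp.hasSum_single (by simp) x)
        (Filter.Eventually.of_forall fun s => ?_)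
      exact Submodule.sum_mem _ fun i _ => Submodule.subset_span ⟨⟨i, x i⟩, rfl⟩
    · rintro _ ⟨⟨π, ξ⟩, rfl⟩
      have h : ∀ g : G, (lpUnitary fun π : BundledUnitaryRep G => π.rep.toHom g)
          (lp.single 2 π ξ : UniversalSpace G) = lp.single 2 π (π.rep.toHom g ξ) := by
        intro g
        ext i
        by_cases hi : i = π
        · subst hi; simp [lpUnitary]
        · simp [lpUnitary, hi]
      simp only [MonoidHom.coe_mk, OneHom.coe_mk, h]
      exact (lp.singleContinuousLinearMap ℂ (fun π : BundledUnitaryRep G => π.space) 2 π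
        ).continuous.comp (π.rep.continuous_apply ξ)

/-- The group C*-algebra `C*(G)`: the C*-algebra of operators generated by the image of `C_c(G)`
under the (integrated) universal representation. The image is already a `*`-algebra, and it does
not depend on the normalisation of the Haar measure `μ`. -/
noncomputable def groupCStarAlgebra (G : Type u) [Group G] [TopologicalSpace G]
    [MeasurableSpace G] [BorelSpace G] (μ : Measure G) [IsFiniteMeasureOnCompacts μ] :
    NonUnitalStarSubalgebra ℂ (UniversalSpace G →L[ℂ] UniversalSpace G) :=
  (NonUnitalStarAlgebra.adjoin ℂ
    (Set.range fun f : C_c(G, ℂ) => (universalRep G).integrated μ f)).topologicalClosure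

theorem integrated_mem_groupCStarAlgebra {G : Type u} [Group G] [TopologicalSpace G]
    [MeasurableSpace G] [BorelSpace G] (μ : Measure G) [IsFiniteMeasureOnCompacts μ]
    (f : C_c(G, ℂ)) : (universalRep G).integrated μ f ∈ groupCStarAlgebra G μ :=
  NonUnitalStarSubalgebra.le_topologicalClosure _
    (NonUnitalStarAlgebra.subset_adjoin ℂ _ ⟨f, rfl⟩)

/-! ### Tensor products -/

/-- The Hilbert space tensor product: the completion of the algebraic tensor product. -/
def HilbertTensor (H : Type*) [NormedAddCommGroup H] [InnerProductSpace ℂ H]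
    (V : Type*) [NormedAddCommGroup V] [InnerProductSpace ℂ V] : Type _ :=
  UniformSpace.Completion (H ⊗[ℂ] V)

section Tensor

variable {H : Type*} [NormedAddCommGroup H] [InnerProductSpace ℂ H]
  {V : Type*} [NormedAddCommGroup V] [InnerProductSpace ℂ V]

noncomputable instance : NormedAddCommGroup (HilbertTensor H V) :=
  inferInstanceAs (NormedAddCommGroup (UniformSpace.Completion (H ⊗[ℂ] V)))

noncomputable instance : InnerProductSpace ℂ (HilbertTensor H V) :=
  inferInstanceAs (InnerProductSpace ℂ (UniformSpace.Completion (H ⊗[ℂ] V)))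

instance : CompleteSpace (HilbertTensor H V) :=
  inferInstanceAs (CompleteSpace (UniformSpace.Completion (H ⊗[ℂ] V)))

/-- The canonical isometric embedding of the algebraic tensor product. -/
noncomputable def HilbertTensor.incl : H ⊗[ℂ] V →ₗᵢ[ℂ] HilbertTensor H V :=
  UniformSpace.Completion.toComplₗᵢ

theorem HilbertTensor.denseRange_incl :
    DenseRange (HilbertTensor.incl : H ⊗[ℂ] V →ₗᵢ[ℂ] HilbertTensor H V) :=
  UniformSpace.Completion.denseRange_coe (α := H ⊗[ℂ] V)

/-- The operator `a ⊗ T` on the Hilbert space tensor product. -/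
noncomputable def opTensor (a : H →L[ℂ] H) (T : V →L[ℂ] V) :
    HilbertTensor H V →L[ℂ] HilbertTensor H V :=
  ContinuousLinearMap.completion (TensorProduct.mapL a T)

theorem opTensor_incl (a : H →L[ℂ] H) (T : V →L[ℂ] V) (x : H ⊗[ℂ] V) :
    opTensor a T (HilbertTensor.incl x) = HilbertTensor.incl (TensorProduct.mapL a T x) :=
  ContinuousLinearMap.completion_apply_coe (TensorProduct.mapL a T) x

theorem opTensor_mul (a b : H →L[ℂ] H) (S T : V →L[ℂ] V) :
    opTensor (a * b) (S * T) = opTensor a S * opTensor b T := by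
  refine DFunLike.coe_injective (HilbertTensor.denseRange_incl.equalizer
    (ContinuousLinearMap.continuous _) (ContinuousLinearMap.continuous _) (funext fun x => ?_))
  change opTensor _ _ _ = opTensor _ _ (opTensor _ _ _)
  simp only [opTensor_incl, TensorProduct.mapL_mul]
  rfl

theorem opTensor_one : opTensor (1 : H →L[ℂ] H) (1 : V →L[ℂ] V) = 1 := by
  refine DFunLike.coe_injective (HilbertTensor.denseRange_incl.equalizer
    (ContinuousLinearMap.continuous _) (ContinuousLinearMap.continuous _) (funext fun x => ?_))
  change opTensor _ _ _ = HilbertTensor.incl x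
  rw [opTensor_incl]
  exact congrArg _ (DFunLike.congr_fun TensorProduct.mapL_id_id x)

/-- The tensor product `u ⊗ w` of unitary operators. -/
noncomputable def unitaryTensor (e : H ≃ₗᵢ[ℂ] H) (f : V ≃ₗᵢ[ℂ] V) :
    HilbertTensor H V ≃ₗᵢ[ℂ] HilbertTensor H V where
  toFun := opTensor (e : H →L[ℂ] H) (f : V →L[ℂ] V)
  invFun := opTensor (e.symm : H →L[ℂ] H) (f.symm : V →L[ℂ] V)
  map_add' := map_add _
  map_smul' := map_smul _
  left_inv x := by
    have h1 : (e.symm : H →L[ℂ] H) * (e : H →L[ℂ] H) = 1 := by ext; simp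
    have h2 : (f.symm : V →L[ℂ] V) * (f : V →L[ℂ] V) = 1 := by ext; simp
    have h := DFunLike.congr_fun (opTensor_mul (e.symm : H →L[ℂ] H) (e : H →L[ℂ] H)
      (f.symm : V →L[ℂ] V) (f : V →L[ℂ] V)) x
    rw [h1, h2, opTensor_one] at h
    exact h.symm
  right_inv x := by
    have h1 : (e : H →L[ℂ] H) * (e.symm : H →L[ℂ] H) = 1 := by ext; simp
    have h2 : (f : V →L[ℂ] V) * (f.symm : V →L[ℂ] V) = 1 := by ext; simp
    have h := DFunLike.congr_fun (opTensor_mul (e : H →L[ℂ] H) (e.symm : H →L[ℂ] H)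
      (f : V →L[ℂ] V) (f.symm : V →L[ℂ] V)) x
    rw [h1, h2, opTensor_one] at h
    exact h.symm
  norm_map' x := by
    have h : (fun x => ‖opTensor (e : H →L[ℂ] H) (f : V →L[ℂ] V) x‖) = fun x => ‖x‖ := by
      refine HilbertTensor.denseRange_incl.equalizer
        (ContinuousLinearMap.continuous _).norm continuous_norm (funext fun x => ?_)
      simp only [Function.comp_apply, opTensor_incl, LinearIsometry.norm_map]
      rw [TensorProduct.mapL_apply]
      exact TensorProduct.norm_map e.toLinearIsometry f.toLinearIsometry x
    exact congrFun h x

theorem unitaryTensor_tmul (e : H ≃ₗᵢ[ℂ] H) (f : V ≃ₗᵢ[ℂ] V) (x : H) (y : V) :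
    unitaryTensor e f (HilbertTensor.incl (x ⊗ₜ[ℂ] y)) =
      HilbertTensor.incl (e x ⊗ₜ[ℂ] f y) :=
  opTensor_incl _ _ _

/-- The tensor product representation `g ↦ π(g) ⊗ σ(g)`. -/
noncomputable def UnitaryRep.tensor {G : Type*} [Group G] [TopologicalSpace G]
    (π : UnitaryRep G H) (σ : UnitaryRep G V) : UnitaryRep G (HilbertTensor H V) where
  toHom :=
    { toFun := fun g => unitaryTensor (π.toHom g) (σ.toHom g)
      map_one' := by
        ext x
        change opTensor _ _ x = x
        have h1 : ((π.toHom 1 : H ≃ₗᵢ[ℂ] H) : H →L[ℂ] H) = 1 := by ext; simp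
        have h2 : ((σ.toHom 1 : V ≃ₗᵢ[ℂ] V) : V →L[ℂ] V) = 1 := by ext; simp
        rw [h1, h2, opTensor_one]; rfl
      map_mul' := fun g h => by
        ext x
        have h1 : ((π.toHom (g * h) : H ≃ₗᵢ[ℂ] H) : H →L[ℂ] H) =
          (π.toHom g : H →L[ℂ] H) * (π.toHom h : H →L[ℂ] H) := by ext; simp
        have h2 : ((σ.toHom (g * h) : V ≃ₗᵢ[ℂ] V) : V →L[ℂ] V) =
          (σ.toHom g : V →L[ℂ] V) * (σ.toHom h : V →L[ℂ] V) := by ext; simp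
        change opTensor _ _ x = opTensor _ _ (opTensor _ _ x)
        rw [h1, h2, opTensor_mul]; rfl }
  continuous_apply := by
    apply UnitaryRep.continuous_of_dense _
      (Set.range fun p : H × V => (HilbertTensor.incl (p.1 ⊗ₜ[ℂ] p.2) : HilbertTensor H V))
    · have key : Set.range (HilbertTensor.incl : H ⊗[ℂ] V →ₗᵢ[ℂ] HilbertTensor H V) ⊆
          (Submodule.span ℂ (Set.range fun p : H × V =>
            (HilbertTensor.incl (p.1 ⊗ₜ[ℂ] p.2) : HilbertTensor H V)) :
              Set (HilbertTensor H V)) := by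
        rintro _ ⟨x, rfl⟩
        induction x using TensorProduct.induction_on with
        | zero => simp
        | tmul x y => exact Submodule.subset_span ⟨(x, y), rfl⟩
        | add x y hx hy =>
          rw [map_add]
          exact Submodule.add_mem _ hx hy
      exact (HilbertTensor.denseRange_incl.mono key).closure_eq
    · rintro _ ⟨⟨x, y⟩, rfl⟩
      simp only [MonoidHom.coe_mk, OneHom.coe_mk, unitaryTensor_tmul]
      refine HilbertTensor.incl.continuous.comp ?_
      exact TensorProduct.continuous_tmul.comp
        ((π.continuous_apply x).prodMk (σ.continuous_apply y))

/-- The (spatial) C*-tensor product `A ⊗ B(V)` of a C*-algebra `A` of operators on `H` with `B(V)`: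
the C*-algebra of operators on the Hilbert space `H ⊗ V` generated by the operators `a ⊗ T`
(their linear span is already a `*`-algebra). -/
noncomputable def cstarTensorEnd [CompleteSpace H]
    (A : NonUnitalStarSubalgebra ℂ (H →L[ℂ] H)) (V : Type*) [NormedAddCommGroup V]
    [InnerProductSpace ℂ V] :
    NonUnitalStarSubalgebra ℂ (HilbertTensor H V →L[ℂ] HilbertTensor H V) :=
  (NonUnitalStarAlgebra.adjoin ℂ
    {x | ∃ a ∈ A, ∃ T : V →L[ℂ] V, x = opTensor a T}).topologicalClosure

instance cstarTensorEnd.isClosed [CompleteSpace H] (A : NonUnitalStarSubalgebra ℂ (H →L[ℂ] H)) :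
    IsClosed (cstarTensorEnd A V : Set (HilbertTensor H V →L[ℂ] HilbertTensor H V)) :=
  NonUnitalStarSubalgebra.isClosed_topologicalClosure _

end Tensor

/-! ### Corners and ideals -/

section CornersIdeals

variable {B : Type*} [NonUnitalCStarAlgebra B]

/-- The corner `p A p = {x ∈ A | p x = x = x p}` of a closed star-subalgebra `A` cut by a
projection `p`; see `mem_corner_iff`. -/
def corner (A : NonUnitalStarSubalgebra ℂ B) (p : B) (hp : IsStarProjection p) :
    NonUnitalStarSubalgebra ℂ B where
  carrier := {x | x ∈ A ∧ p * x = x ∧ x * p = x}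
  zero_mem' := ⟨zero_mem A, mul_zero p, zero_mul p⟩
  add_mem' := by
    rintro x y ⟨hx, hx1, hx2⟩ ⟨hy, hy1, hy2⟩
    exact ⟨add_mem hx hy, by rw [mul_add, hx1, hy1], by rw [add_mul, hx2, hy2]⟩
  mul_mem' := by
    rintro x y ⟨hx, hx1, hx2⟩ ⟨hy, hy1, hy2⟩
    exact ⟨mul_mem hx hy, by rw [← mul_assoc, hx1], by rw [mul_assoc, hy2]⟩
  smul_mem' := by
    rintro c x ⟨hx, hx1, hx2⟩
    exact ⟨A.smul_mem c hx, by rw [mul_smul_comm, hx1], by rw [smul_mul_assoc, hx2]⟩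
  star_mem' := by
    rintro x ⟨hx, hx1, hx2⟩
    have h := hp.isSelfAdjoint.star_eq
    refine ⟨star_mem hx, ?_, ?_⟩
    · conv_lhs => rw [← h]
      rw [← star_mul, hx2]
    · conv_lhs => rw [← h]
      rw [← star_mul, hx1]

theorem mem_corner_iff {A : NonUnitalStarSubalgebra ℂ B} {p : B} (hp : IsStarProjection p)
    (hpA : p ∈ A) (x : B) : x ∈ corner A p hp ↔ ∃ a ∈ A, x = p * a * p := by
  constructor
  · rintro ⟨hx, hx1, hx2⟩
    exact ⟨x, hx, by rw [hx1, hx2]⟩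
  · rintro ⟨a, ha, rfl⟩
    have h : p * p = p := hp.isIdempotentElem
    refine ⟨mul_mem (mul_mem hpA ha) hpA, ?_, ?_⟩
    · rw [← mul_assoc, ← mul_assoc, h]
    · rw [mul_assoc, h]

instance corner.isClosed (A : NonUnitalStarSubalgebra ℂ B) [hA : IsClosed (A : Set B)] (p : B)
    (hp : IsStarProjection p) : IsClosed (corner A p hp : Set B) :=
  hA.inter ((isClosed_eq (continuous_const.mul continuous_id) continuous_id).inter
    (isClosed_eq (continuous_id.mul continuous_const) continuous_id))

/-- The closed two-sided ideal of `A` generated by a self-adjoint element `q` of `A`: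
the closed linear span of `A q A`. -/
def closedIdeal (A : NonUnitalStarSubalgebra ℂ B) (q : B) (hqA : q ∈ A) (hq : IsSelfAdjoint q) :
    NonUnitalStarSubalgebra ℂ B :=
  NonUnitalStarSubalgebra.topologicalClosure
    { Submodule.span ℂ {x | ∃ a ∈ A, ∃ b ∈ A, x = a * q * b} with
      mul_mem' := by
        intro x y hx hy
        induction hx, hy using Submodule.span_induction₂ with
        | mem_mem x y hx hy =>
          obtain ⟨a, ha, b, hb, rfl⟩ := hx
          obtain ⟨c, hc, d, hd, rfl⟩ := hy
          exact Submodule.subset_span ⟨a * q * b * c, mul_mem (mul_mem (mul_mem ha hqA) hb) hc,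
            d, hd, by simp only [mul_assoc]⟩
        | zero_left y _ => rw [zero_mul]; exact Submodule.zero_mem _
        | zero_right x _ => rw [mul_zero]; exact Submodule.zero_mem _
        | add_left x y z _ _ _ h1 h2 => rw [add_mul]; exact Submodule.add_mem _ h1 h2
        | add_right x y z _ _ _ h1 h2 => rw [mul_add]; exact Submodule.add_mem _ h1 h2
        | smul_left c x y _ _ h => rw [smul_mul_assoc]; exact Submodule.smul_mem _ c h
        | smul_right c x y _ _ h => rw [mul_smul_comm]; exact Submodule.smul_mem _ c h
      star_mem' := by
        intro x hx
        induction hx using Submodule.span_induction with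
        | mem x hx =>
          obtain ⟨a, ha, b, hb, rfl⟩ := hx
          exact Submodule.subset_span ⟨star b, star_mem hb, star a, star_mem ha, by
            rw [star_mul, star_mul, hq.star_eq, mul_assoc]⟩
        | zero => rw [star_zero]; exact Submodule.zero_mem _
        | add x y _ _ h1 h2 => rw [star_add]; exact Submodule.add_mem _ h1 h2
        | smul c x _ h => rw [star_smul]; exact Submodule.smul_mem _ _ h }

theorem coe_closedIdeal (A : NonUnitalStarSubalgebra ℂ B) (q : B) (hqA : q ∈ A)
    (hq : IsSelfAdjoint q) : (closedIdeal A q hqA hq : Set B) =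
      closure (Submodule.span ℂ {x | ∃ a ∈ A, ∃ b ∈ A, x = a * q * b} : Set B) := rfl

instance closedIdeal.isClosed (A : NonUnitalStarSubalgebra ℂ B) (q : B) (hqA : q ∈ A)
    (hq : IsSelfAdjoint q) : IsClosed (closedIdeal A q hqA hq : Set B) :=
  NonUnitalStarSubalgebra.isClosed_topologicalClosure _

end CornersIdeals

/-! ### Averaging over a compact group -/

section CompactGroup

variable {K : Type*} [Group K] [TopologicalSpace K] [IsTopologicalGroup K] [CompactSpace K]
  [MeasurableSpace K] [BorelSpace K] (ν : Measure K) [ν.IsMulLeftInvariant]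
  [IsProbabilityMeasure ν]

theorem integral_comp_inv_of_compact (φ : K → ℂ) (hφ : Continuous φ) :
    ∫ k, φ k⁻¹ ∂ν = ∫ k, φ k ∂ν := by
  have hsw := integral_integral_swap_of_hasCompactSupport (f := fun h k : K => φ (k⁻¹ * h))
    (μ := ν) (ν := ν) (by fun_prop) (HasCompactSupport.of_compactSpace _)
  have h1 : ∀ h : K, ∫ k, φ (k⁻¹ * h) ∂ν = ∫ k, φ k⁻¹ ∂ν := fun h => by
    rw [← integral_mul_left_eq_self (fun k => φ (k⁻¹ * h)) h]
    simp
  have h2 : ∀ k : K, ∫ h, φ (k⁻¹ * h) ∂ν = ∫ h, φ h ∂ν := fun k =>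
    integral_mul_left_eq_self φ k⁻¹
  simpa [h1, h2] using hsw

variable {H : Type*} [NormedAddCommGroup H] [InnerProductSpace ℂ H] [CompleteSpace H]
  (ρ : UnitaryRep K H)

theorem UnitaryRep.isSelfAdjoint_integrated (f : C_c(K, ℂ)) (hf : ∀ k, star (f k⁻¹) = f k) :
    IsSelfAdjoint (ρ.integrated ν f) := by
  rw [ContinuousLinearMap.isSelfAdjoint_iff_isSymmetric]
  intro ξ η
  change inner ℂ (ρ.integrated ν f ξ) η = inner ℂ ξ (ρ.integrated ν f η)
  rw [ρ.integrated_apply, ρ.integrated_apply, ← integral_inner (ρ.integrable_smul ν f η) ξ,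
    ← inner_conj_symm, ← integral_inner (ρ.integrable_smul ν f ξ) η, ← integral_conj,
    ← integral_comp_inv_of_compact]
  · refine integral_congr_ae (Filter.Eventually.of_forall fun k => ?_)
    have h : inner ℂ (ρ.op k⁻¹ ξ) η = inner ℂ ξ (ρ.op k η) := by
      have h2 := (ρ.toHom k).inner_map_map (ρ.toHom k⁻¹ ξ) η
      rw [UnitaryRep.apply_apply_inv] at h2
      exact h2.symm
    simp only [inner_smul_right, map_mul, inner_conj_symm, h]
    rw [← hf k]
    rfl
  · have h := ρ.continuous_apply ξ
    have h' := map_continuous f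
    unfold UnitaryRep.op
    simp only [inner_smul_right]
    exact Complex.continuous_conj.comp (h'.mul (continuous_const.inner h))

/-- The constant function `1` on a compact group. -/
def compactOne (K : Type*) [TopologicalSpace K] [CompactSpace K] : C_c(K, ℂ) where
  toFun _ := 1
  continuous_toFun := continuous_const
  hasCompactSupport' := HasCompactSupport.of_compactSpace _

theorem UnitaryRep.isStarProjection_average :
    IsStarProjection (ρ.integrated ν (compactOne K)) where
  isSelfAdjoint := ρ.isSelfAdjoint_integrated ν _ fun _ => star_one ℂ
  isIdempotentElem := by
    have hfix : ∀ (k : K) (ξ : H), ρ.op k (ρ.integrated ν (compactOne K) ξ) =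
        ρ.integrated ν (compactOne K) ξ := by
      intro k ξ
      rw [ρ.integrated_apply, ← ContinuousLinearMap.integral_comp_comm _
        (ρ.integrable_smul ν _ ξ),
        ← integral_mul_left_eq_self (fun g => compactOne K g • ρ.op g ξ) k]
      refine integral_congr_ae (Filter.Eventually.of_forall fun g => ?_)
      simp [compactOne, UnitaryRep.op]
    ext ξ
    change ρ.integrated ν (compactOne K) (ρ.integrated ν (compactOne K) ξ) = _
    conv_lhs => rw [ρ.integrated_apply]
    simp only [hfix]
    simp [compactOne]

end CompactGroup

/-! ### Compact open subgroups -/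

section CompactOpen

variable {L : Type u} [Group L] [TopologicalSpace L] [IsTopologicalGroup L] [MeasurableSpace L]
  [BorelSpace L] (μ : Measure L) [μ.IsHaarMeasure] (M : OpenSubgroup L)

/-- The restriction of Haar measure to an open subgroup. -/
noncomputable def subgroupHaar : Measure M := μ.comap (Subtype.val : M → L)

instance : IsTopologicalGroup M :=
  inferInstanceAs (IsTopologicalGroup (M : Subgroup L))

instance : (subgroupHaar μ M).IsHaarMeasure :=
  Measure.IsHaarMeasure.comap (mH := inferInstance) μ (f := (M : Subgroup L).subtype)
    M.isOpen.isOpenEmbedding_subtypeVal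

theorem isProbabilityMeasure_subgroupHaar (hμ : μ (M : Set L) = 1) :
    IsProbabilityMeasure (subgroupHaar μ M) where
  measure_univ := by
    refine ((MeasurableEmbedding.subtype_coe M.isOpen.measurableSet).comap_apply μ
      Set.univ).trans ?_
    rw [Set.image_univ, Subtype.range_coe]
    exact hμ

variable {M} [CompactSpace M]

open Classical in
/-- The extension by zero to `L` of a continuous function on a compact open subgroup `M`. -/
noncomputable def extendByZero (c : C(M, ℂ)) : C_c(L, ℂ) where
  toFun x := if h : x ∈ M then c ⟨x, h⟩ else 0
  continuous_toFun := by
    rw [continuous_iff_continuousAt]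
    intro x
    by_cases hx : x ∈ M
    · have h := M.isOpen.isOpenEmbedding_subtypeVal.continuousAt_iff
        (g := fun x : L => if h : x ∈ M then c ⟨x, h⟩ else 0) (x := ⟨x, hx⟩)
      refine h.1 ?_
      exact (map_continuous c).continuousAt.congr
        (Filter.Eventually.of_forall fun k => by simp)
    · have hM : IsClosed (M : Set L) := M.isClosed
      refine ContinuousAt.congr (f := fun _ => (0 : ℂ)) continuousAt_const ?_
      filter_upwards [hM.isOpen_compl.mem_nhds hx] with y hy
      have hy' : y ∉ M := hy
      simp [hy']
  hasCompactSupport' :=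
    HasCompactSupport.intro' (isCompact_iff_compactSpace.2 ‹CompactSpace M›) M.isClosed
      fun _ hx => dif_neg hx

theorem integrated_extendByZero {H : Type*} [NormedAddCommGroup H] [InnerProductSpace ℂ H]
    (π : UnitaryRep L H) (c : C(M, ℂ)) : π.integrated μ (extendByZero c) =
      (π.restrict M).integrated (subgroupHaar μ M)
        (CompactlySupportedContinuousMap.continuousMapEquiv c) := by
  ext ξ
  rw [UnitaryRep.integrated_apply, UnitaryRep.integrated_apply,
    ← setIntegral_eq_integral_of_forall_compl_eq_zero (s := (M : Set L)),
    ← integral_subtype_comap M.isOpen.measurableSet]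
  · refine integral_congr_ae (Filter.Eventually.of_forall fun k => ?_)
    have h : extendByZero c (k : L) = c k := dif_pos k.2
    simp only [h]
    rfl
  · intro x hx
    have h : extendByZero c x = 0 := dif_neg hx
    rw [h, zero_smul]

variable {V : Type v} [NormedAddCommGroup V] [InnerProductSpace ℂ V] (σ : UnitaryRep M V)

/-- The function `k ↦ d(σ) Tr(σ(k))` on `M`, where `d(σ) = dim V`. -/
noncomputable def scaledCharacter : C(M, ℂ) where
  toFun k := (Module.finrank ℂ V : ℂ) * LinearMap.trace ℂ V (σ.op k).toLinearMap
  continuous_toFun := by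
    by_cases hV : FiniteDimensional ℂ V
    · simp only [LinearMap.trace_eq_sum_inner _ (stdOrthonormalBasis ℂ V)]
      exact continuous_const.mul (continuous_finsetSum _ fun i _ =>
        continuous_const.inner (σ.continuous_apply _))
    · simp only [Module.finrank_of_not_finite hV, Nat.cast_zero, zero_mul]
      exact continuous_const

theorem star_scaledCharacter_inv (k : M) :
    star (scaledCharacter σ k⁻¹) = scaledCharacter σ k := by
  change star ((Module.finrank ℂ V : ℂ) * LinearMap.trace ℂ V (σ.op k⁻¹).toLinearMap) =
    (Module.finrank ℂ V : ℂ) * LinearMap.trace ℂ V (σ.op k).toLinearMap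
  by_cases hV : FiniteDimensional ℂ V
  · simp only [LinearMap.trace_eq_sum_inner _ (stdOrthonormalBasis ℂ V), star_mul', star_natCast,
      star_sum]
    congr 1
    refine Finset.sum_congr rfl fun i _ => ?_
    have h2 := (σ.toHom k).inner_map_map (σ.toHom k⁻¹ (stdOrthonormalBasis ℂ V i))
      (stdOrthonormalBasis ℂ V i)
    rw [UnitaryRep.apply_apply_inv] at h2
    exact (inner_conj_symm _ _).trans h2.symm
  · simp [Module.finrank_of_not_finite hV]

/-- The element `ψ_σ = d(σ) Tr σ` of `C_c(M) ⊆ C_c(L)`, as an element of `C*(L)`. -/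
noncomputable def characterProjection : UniversalSpace L →L[ℂ] UniversalSpace L :=
  (universalRep L).integrated μ (extendByZero (scaledCharacter σ))

theorem isSelfAdjoint_characterProjection (hμ : μ (M : Set L) = 1) :
    IsSelfAdjoint (characterProjection μ σ) := by
  have := isProbabilityMeasure_subgroupHaar μ M hμ
  rw [characterProjection, integrated_extendByZero]
  exact UnitaryRep.isSelfAdjoint_integrated _ _ _ fun k => star_scaledCharacter_inv σ k

/-- The ideal of `C*(L)` generated by `ψ_σ`: the closed linear span of `C*(L) ψ_σ C*(L)`. -/
noncomputable def characterIdeal (hμ : μ (M : Set L) = 1) :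
    NonUnitalStarSubalgebra ℂ (UniversalSpace L →L[ℂ] UniversalSpace L) :=
  closedIdeal (groupCStarAlgebra L μ) (characterProjection μ σ)
    (integrated_mem_groupCStarAlgebra μ _) (isSelfAdjoint_characterProjection μ σ hμ)

instance characterIdeal.isClosed (hμ : μ (M : Set L) = 1) :
    IsClosed (characterIdeal μ σ hμ : Set (UniversalSpace L →L[ℂ] UniversalSpace L)) :=
  closedIdeal.isClosed _ _ _ _

/-- The operator `p_σ = ∫_M λ(k) ⊗ σ(k) dk`, where `λ` is the universal representation of `L`. -/
noncomputable def heckeProjection :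
    HilbertTensor (UniversalSpace L) V →L[ℂ] HilbertTensor (UniversalSpace L) V :=
  (((universalRep L).restrict M).tensor σ).integrated (subgroupHaar μ M) (compactOne M)

theorem isStarProjection_heckeProjection (hμ : μ (M : Set L) = 1) :
    IsStarProjection (heckeProjection μ σ) :=
  have := isProbabilityMeasure_subgroupHaar μ M hμ
  UnitaryRep.isStarProjection_average _ _

/-- The generalised Hecke C*-algebra `p_σ (C*(L) ⊗ B(V)) p_σ`. -/
noncomputable def heckeCStarAlgebra (hμ : μ (M : Set L) = 1) :
    NonUnitalStarSubalgebra ℂ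
      (HilbertTensor (UniversalSpace L) V →L[ℂ] HilbertTensor (UniversalSpace L) V) :=
  corner (cstarTensorEnd (groupCStarAlgebra L μ) V) (heckeProjection μ σ)
    (isStarProjection_heckeProjection μ σ hμ)

instance heckeCStarAlgebra.isClosed (hμ : μ (M : Set L) = 1) :
    IsClosed (heckeCStarAlgebra μ σ hμ : Set
      (HilbertTensor (UniversalSpace L) V →L[ℂ] HilbertTensor (UniversalSpace L) V)) :=
  corner.isClosed _ _ _

end CompactOpen

/-! ### Morita-Rieffel equivalence -/

/-- An `A`-`B` imprimitivity bimodule structure on `X`: a full left Hilbert `A`-module and a full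
right Hilbert `B`-module such that the actions commute and are by adjointable operators, and
`_A⟨x, y⟩ z = x ⟨y, z⟩_B`. The given complete norm is the Hilbert module norm on both sides. -/
structure ImprimitivityBimodule (A : Type*) (B : Type*) (X : Type*)
    [NonUnitalCStarAlgebra A] [NonUnitalCStarAlgebra B]
    [NormedAddCommGroup X] [NormedSpace ℂ X] [CompleteSpace X] where
  /-- the left action `a x` -/
  lact : A →ₗ[ℂ] X →ₗ[ℂ] X
  /-- the right action `x b`, written `ract b x` -/
  ract : B →ₗ[ℂ] X →ₗ[ℂ] X
  lact_mul : ∀ a a' x, lact (a * a') x = lact a (lact a' x)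
  ract_mul : ∀ b b' x, ract (b * b') x = ract b' (ract b x)
  lact_ract : ∀ a b x, lact a (ract b x) = ract b (lact a x)
  /-- the left inner product `_A⟨x, y⟩`, linear in `x` and conjugate-linear in `y` -/
  linner : X →ₗ[ℂ] X →ₗ⋆[ℂ] A
  /-- the right inner product `⟨x, y⟩_B`, conjugate-linear in `x` and linear in `y` -/
  rinner : X →ₗ⋆[ℂ] X →ₗ[ℂ] B
  star_linner : ∀ x y, star (linner x y) = linner y x
  star_rinner : ∀ x y, star (rinner x y) = rinner y x
  linner_lact : ∀ a x y, linner (lact a x) y = a * linner x y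
  rinner_ract : ∀ b x y, rinner x (ract b y) = rinner x y * b
  linner_nonneg : ∀ x, ∃ c, linner x x = star c * c
  rinner_nonneg : ∀ x, ∃ c, rinner x x = star c * c
  norm_linner : ∀ x, ‖linner x x‖ = ‖x‖ ^ 2
  norm_rinner : ∀ x, ‖rinner x x‖ = ‖x‖ ^ 2
  linner_full : closure (Submodule.span ℂ {a | ∃ x y, a = linner x y} : Set A) = Set.univ
  rinner_full : closure (Submodule.span ℂ {b | ∃ x y, b = rinner x y} : Set B) = Set.univ
  rinner_lact : ∀ a x y, rinner (lact a x) y = rinner x (lact (star a) y)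
  linner_ract : ∀ b x y, linner (ract b x) y = linner x (ract (star b) y)
  imprimitivity : ∀ x y z, lact (linner x y) z = ract (rinner y z) x

/-- Two C*-algebras are Morita-Rieffel equivalent if there is an imprimitivity bimodule between
them. -/
def MoritaRieffelEquivalent (A : Type v) (B : Type w) [NonUnitalCStarAlgebra A]
    [NonUnitalCStarAlgebra B] : Prop :=
  ∃ (X : Type (max v w)) (_ : NormedAddCommGroup X) (_ : NormedSpace ℂ X) (_ : CompleteSpace X),
    Nonempty (ImprimitivityBimodule A B X)

/-!
Let `C = C⋆(L)` act on the universal space `H`. The imprimitivity bimodule is the concrete space of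
operators `X = p_σ (C ⊗ V)` from `H` to `H ⊗ V`, the closed linear span of the operators
`ξ ↦ p_σ (c ξ ⊗ v)`. Products of operators supply both actions and both inner products, `x y⋆` on
the left and `x⋆ y` on the right, so the algebraic axioms hold by associativity
(`ternaryBimodule`). What has to be shown is that `X X⋆` spans a dense subspace of
`p_σ (C ⊗ B(V)) p_σ`, and `X⋆ X` a dense subspace of the ideal generated by `ψ_σ`.

The first is a consequence of the density of `C C⋆` in `C`. For the second, `X⋆ X` is spanned by the
elements `a φ b`, where `φ = ∫ ⟨v, σ(k) w⟩ λ(k) dk` runs through the blocks of `p_σ`. The block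
expansion of the trace shows that `ψ_σ` is a linear combination of blocks
(`UnitaryRep.integrated_eq_sum_blocks`), which gives one inclusion. The other one follows from
`φ = φ ψ_σ`, a consequence of `p_σ (ψ_σ ⊗ 1) (ξ ⊗ v) = p_σ (ξ ⊗ v)`
(`UnitaryRep.average_comp_tensorRight_comp_integrated`): since `p_σ` absorbs `λ(k) ⊗ σ(k)`, the
identity reduces to `∫ d(σ) Tr(σ(k)) σ(k⁻¹) v dk = v`, which is Schur orthogonality.

The Schur relations are proved by averaging rank one operators. The same averages, being compact
intertwiners, show that `σ` is finite-dimensional. This is indispensable: on an infinite-dimensional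
space the formula for `ψ_σ` would give `0`.
-/

/-! ### Closed `*`-subalgebras -/

/-- A positive element of a closed `*`-subalgebra is positive within the subalgebra: its square root
is given by the continuous functional calculus, which does not leave the subalgebra. -/
theorem NonUnitalStarSubalgebra.exists_star_mul_self_eq {B : Type*} [NonUnitalCStarAlgebra B]
    (A : NonUnitalStarSubalgebra ℂ B) [IsClosed (A : Set B)] {b : B} (hb : star b * b ∈ A) :
    ∃ c ∈ A, star b * b = star c * c := by
  let _ : PartialOrder B := CStarAlgebra.spectralOrder B
  have : StarOrderedRing B := CStarAlgebra.spectralOrderedRing B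
  have h0 : 0 ≤ star b * b := star_mul_self_nonneg b
  have hs : IsSelfAdjoint (CFC.sqrt (star b * b)) := (CFC.sqrt_nonneg _).isSelfAdjoint
  refine ⟨CFC.sqrt (star b * b), ?_, ?_⟩
  · rw [CFC.sqrt_eq_real_sqrt _ h0]
    exact cfcₙ_mem (𝕜' := ℂ) _ hb
  · rw [hs.star_eq, CFC.sqrt_mul_sqrt_self _ h0]

/-- The products `b c⋆` are dense in a C⋆-algebra, since `a = lim a e` along an approximate unit. -/
theorem NonUnitalStarSubalgebra.mem_closure_mul_star {B : Type*} [NonUnitalCStarAlgebra B]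
    (A : NonUnitalStarSubalgebra ℂ B) [IsClosed (A : Set B)] {a : B} (ha : a ∈ A) :
    a ∈ closure {x | ∃ b ∈ A, ∃ c ∈ A, x = b * star c} := by
  let _ : PartialOrder A := CStarAlgebra.spectralOrder A
  have : StarOrderedRing A := CStarAlgebra.spectralOrderedRing A
  have hl := CStarAlgebra.increasingApproximateUnit A
  have ht := (continuous_subtype_val.tendsto _).comp (hl.tendsto_mul_left ⟨a, ha⟩)
  refine mem_closure_of_tendsto ht (Filter.Eventually.of_forall fun e => ?_)
  exact ⟨a, ha, star (e : B), star_mem e.2, by simp⟩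

/-- Density of a span may be checked in the ambient algebra. -/
theorem NonUnitalStarSubalgebra.closure_span_eq_univ {B : Type*} [NonUnitalCStarAlgebra B]
    (A : NonUnitalStarSubalgebra ℂ B) {s : Set A} {t : Set B} (hts : t ⊆ Subtype.val '' s)
    (h : (A : Set B) ⊆ closure (Submodule.span ℂ t : Set B)) :
    closure (Submodule.span ℂ s : Set A) = Set.univ := by
  refine Set.eq_univ_of_forall fun a => ?_
  rw [closure_subtype]
  refine closure_mono ?_ (h a.2)
  have := Submodule.map_span A.toSubmodule.subtype s
  change (Submodule.span ℂ t : Set B) ⊆ (Submodule.map A.toSubmodule.subtype (Submodule.span ℂ s))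
  rw [this]
  exact Submodule.span_mono hts

theorem norm_comp_adjoint_self {H K : Type*} [NormedAddCommGroup H] [InnerProductSpace ℂ H]
    [CompleteSpace H] [NormedAddCommGroup K] [InnerProductSpace ℂ K] [CompleteSpace K]
    (x : H →L[ℂ] K) : ‖x ∘L x.adjoint‖ = ‖x‖ ^ 2 := by
  have h := ContinuousLinearMap.norm_adjoint_comp_self x.adjoint
  rw [ContinuousLinearMap.adjoint_adjoint, LinearIsometryEquiv.norm_map] at h
  rw [h, sq]

/-- Positivity of `x⋆ x` within a closed `*`-subalgebra, for an operator `x` between two spaces. -/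
theorem exists_adjoint_comp_self_eq {H K : Type*} [NormedAddCommGroup H] [InnerProductSpace ℂ H]
    [CompleteSpace H] [NormedAddCommGroup K] [InnerProductSpace ℂ K] [CompleteSpace K]
    (A : NonUnitalStarSubalgebra ℂ (H →L[ℂ] H)) [IsClosed (A : Set (H →L[ℂ] H))]
    (x : H →L[ℂ] K) (hx : x.adjoint ∘L x ∈ A) :
    ∃ c ∈ A, x.adjoint ∘L x = star c * c := by
  have h0 : 0 ≤ x.adjoint ∘L x := by
    rw [ContinuousLinearMap.nonneg_iff_isPositive]
    exact ContinuousLinearMap.isPositive_adjoint_comp_self x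
  obtain ⟨b, hb⟩ := CStarAlgebra.nonneg_iff_eq_star_mul_self.1 h0
  rw [hb] at hx ⊢
  exact A.exists_star_mul_self_eq hx

/-! ### Imprimitivity bimodules made of operators -/

section Ternary

variable {H : Type v} [NormedAddCommGroup H] [InnerProductSpace ℂ H] [CompleteSpace H]
  {K : Type w} [NormedAddCommGroup K] [InnerProductSpace ℂ K] [CompleteSpace K]

theorem adjoint_comp_comp (a : K →L[ℂ] K) (x y : H →L[ℂ] K) :
    (a ∘L x).adjoint ∘L y = x.adjoint ∘L (star a ∘L y) := by
  rw [ContinuousLinearMap.adjoint_comp, ContinuousLinearMap.star_eq_adjoint,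
    ContinuousLinearMap.comp_assoc]

theorem comp_comp_adjoint (b : H →L[ℂ] H) (x y : H →L[ℂ] K) :
    (x ∘L b) ∘L y.adjoint = x ∘L (y ∘L star b).adjoint := by
  rw [ContinuousLinearMap.adjoint_comp, ContinuousLinearMap.star_eq_adjoint,
    ContinuousLinearMap.adjoint_adjoint, ContinuousLinearMap.comp_assoc]

set_option maxHeartbeats 800000 in
/-- A closed space `X` of operators from `H` to `K` is an imprimitivity bimodule between a
C⋆-algebra `A` on `K` and a C⋆-algebra `B` on `H` as soon as `A X ⊆ X`, `X B ⊆ X`, and `X X⋆` and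
`X⋆ X` span dense subspaces of `A` and `B`. The actions are composition of operators, the inner
products are `x y⋆` and `x⋆ y`, and the norm is the operator norm, so that the imprimitivity
condition is the associativity `(x y⋆) z = x (y⋆ z)`. -/
noncomputable def ternaryBimodule (A : NonUnitalStarSubalgebra ℂ (K →L[ℂ] K))
    [IsClosed (A : Set (K →L[ℂ] K))]
    (B : NonUnitalStarSubalgebra ℂ (H →L[ℂ] H)) [IsClosed (B : Set (H →L[ℂ] H))]
    (X : Submodule ℂ (H →L[ℂ] K)) [CompleteSpace X]
    (hAX : ∀ a ∈ A, ∀ x ∈ X, a ∘L x ∈ X) (hXB : ∀ b ∈ B, ∀ x ∈ X, x ∘L b ∈ X)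
    (hXX : ∀ x ∈ X, ∀ y ∈ X, x ∘L y.adjoint ∈ A) (hXX' : ∀ x ∈ X, ∀ y ∈ X, x.adjoint ∘L y ∈ B)
    (hA : (A : Set (K →L[ℂ] K)) ⊆
      closure (Submodule.span ℂ {a | ∃ x ∈ X, ∃ y ∈ X, a = x ∘L y.adjoint}))
    (hB : (B : Set (H →L[ℂ] H)) ⊆
      closure (Submodule.span ℂ {b | ∃ x ∈ X, ∃ y ∈ X, b = x.adjoint ∘L y})) :
    ImprimitivityBimodule A B X where
  lact := LinearMap.mk₂ ℂ (fun a x => ⟨(a : K →L[ℂ] K) ∘L (x : H →L[ℂ] K), hAX a a.2 x x.2⟩)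
    (fun a b x => by ext; simp) (fun c a x => by ext; simp) (fun a x y => by ext; simp)
    (fun c a x => by ext; simp)
  ract := LinearMap.mk₂ ℂ (fun b x => ⟨(x : H →L[ℂ] K) ∘L (b : H →L[ℂ] H), hXB b b.2 x x.2⟩)
    (fun a b x => by ext; simp) (fun c a x => by ext; simp) (fun a x y => by ext; simp)
    (fun c a x => by ext; simp)
  lact_mul a a' x := rfl
  ract_mul b b' x := rfl
  lact_ract a b x := rfl
  linner := LinearMap.mk₂'ₛₗ (RingHom.id ℂ) (starRingEnd ℂ)
    (fun x y => ⟨(x : H →L[ℂ] K) ∘L (y : H →L[ℂ] K).adjoint, hXX x x.2 y y.2⟩)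
    (fun a b x => by ext; simp) (fun c a x => by ext; simp) (fun a x y => by ext; simp)
    (fun c a x => by ext; simp [map_smulₛₗ])
  rinner := LinearMap.mk₂'ₛₗ (starRingEnd ℂ) (RingHom.id ℂ)
    (fun x y => ⟨(x : H →L[ℂ] K).adjoint ∘L (y : H →L[ℂ] K), hXX' x x.2 y y.2⟩)
    (fun a b x => by ext; simp) (fun c a x => by ext; simp [map_smulₛₗ]) (fun a x y => by ext; simp)
    (fun c a x => by ext; simp)
  star_linner x y := Subtype.ext <|
    (ContinuousLinearMap.adjoint_comp _ _).trans
      (congrArg (· ∘L _) (ContinuousLinearMap.adjoint_adjoint _))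
  star_rinner x y := Subtype.ext <|
    (ContinuousLinearMap.adjoint_comp _ _).trans
      (congrArg (_ ∘L ·) (ContinuousLinearMap.adjoint_adjoint _))
  linner_lact a x y := rfl
  rinner_ract b x y := rfl
  linner_nonneg x := by
    obtain ⟨c, hc, h⟩ := exists_adjoint_comp_self_eq A (x : H →L[ℂ] K).adjoint
      (by simpa using hXX x x.2 x x.2)
    exact ⟨⟨c, hc⟩, Subtype.ext (by simpa using h)⟩
  rinner_nonneg x := by
    obtain ⟨c, hc, h⟩ := exists_adjoint_comp_self_eq B (x : H →L[ℂ] K) (hXX' x x.2 x x.2)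
    exact ⟨⟨c, hc⟩, Subtype.ext h⟩
  norm_linner x := norm_comp_adjoint_self (x : H →L[ℂ] K)
  norm_rinner x := (ContinuousLinearMap.norm_adjoint_comp_self (x : H →L[ℂ] K)).trans (sq _).symm
  linner_full := by
    refine A.closure_span_eq_univ ?_ hA
    rintro _ ⟨x, hx, y, hy, rfl⟩
    exact ⟨⟨_, hXX x hx y hy⟩, ⟨⟨x, hx⟩, ⟨y, hy⟩, rfl⟩, rfl⟩
  rinner_full := by
    refine B.closure_span_eq_univ ?_ hB
    rintro _ ⟨x, hx, y, hy, rfl⟩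
    exact ⟨⟨_, hXX' x hx y hy⟩, ⟨⟨x, hx⟩, ⟨y, hy⟩, rfl⟩, rfl⟩
  rinner_lact a x y := Subtype.ext (adjoint_comp_comp _ _ _)
  linner_ract b x y := Subtype.ext (comp_comp_adjoint _ _ _)
  imprimitivity x y z := rfl

end Ternary

/-! ### Irreducible representations of compact groups -/

namespace UnitaryRep

open InnerProductSpace (rankOne)

section Basic

variable {G : Type*} [Group G] [TopologicalSpace G]
  {V : Type*} [NormedAddCommGroup V] [InnerProductSpace ℂ V] (σ : UnitaryRep G V)

theorem op_mul (g h : G) (v : V) : σ.op (g * h) v = σ.op g (σ.op h v) := by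
  simp [op]

theorem inner_op_op (k : G) (v w : V) : inner ℂ (σ.op k v) (σ.op k w) = inner ℂ v w :=
  (σ.toHom k).inner_map_map v w

theorem inner_op_inv (k : G) (v w : V) : inner ℂ v (σ.op k⁻¹ w) = inner ℂ (σ.op k v) w := by
  rw [← σ.inner_op_op k v, ← σ.op_mul, mul_inv_cancel]
  simp [op]

end Basic

section Schur

variable {K : Type*} [Group K] [TopologicalSpace K] [CompactSpace K]
  [MeasurableSpace K] [BorelSpace K] (ν : Measure K) [ν.IsMulLeftInvariant]
  [IsProbabilityMeasure ν]
  {V : Type*} [NormedAddCommGroup V] [InnerProductSpace ℂ V] [CompleteSpace V]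
  (σ : UnitaryRep K V)

/-- The average over the group of the rank one operators `|σ(k) v⟩⟨σ(k) w|`, as a Bochner integral
in operator norm. Only rank one operators are averaged, because conjugation of a fixed operator by
`σ(k)` need not be norm continuous in `k` before `V` is known to be finite-dimensional. -/
noncomputable def averageRankOne (v w : V) : V →L[ℂ] V :=
  ∫ k, rankOne ℂ (σ.op k v) (σ.op k w) ∂ν

theorem continuous_rankOne_op (v w : V) :
    Continuous fun k => rankOne ℂ (σ.op k v) (σ.op k w) :=
  ((ContinuousLinearMap.smulRightL ℂ V V).continuous.comp
    ((innerSL ℂ).continuous.comp (σ.continuous_apply w))).clm_apply (σ.continuous_apply v)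

theorem integrable_rankOne_op (v w : V) :
    Integrable (fun k => rankOne ℂ (σ.op k v) (σ.op k w)) ν :=
  (σ.continuous_rankOne_op v w).integrable_of_hasCompactSupport (.of_compactSpace _)

theorem averageRankOne_apply (v w u : V) :
    σ.averageRankOne ν v w u = ∫ k, inner ℂ (σ.op k w) u • σ.op k v ∂ν := by
  rw [averageRankOne, ContinuousLinearMap.integral_apply (σ.integrable_rankOne_op ν v w)]
  simp

theorem inner_averageRankOne (v w u z : V) : inner ℂ z (σ.averageRankOne ν v w u) =
    ∫ k, inner ℂ (σ.op k w) u * inner ℂ z (σ.op k v) ∂ν := by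
  rw [averageRankOne_apply, ← integral_inner]
  · simp [inner_smul_right]
  · exact (((σ.continuous_apply w).inner continuous_const).smul
      (σ.continuous_apply v)).integrable_of_hasCompactSupport (.of_compactSpace _)

/-- Averaged operators are intertwiners. -/
theorem averageRankOne_op [IsTopologicalGroup K] (v w u : V) (h : K) :
    σ.averageRankOne ν v w (σ.op h u) = σ.op h (σ.averageRankOne ν v w u) := by
  refine ext_inner_left ℂ fun z => ?_
  have e := σ.inner_op_inv h⁻¹ z (σ.averageRankOne ν v w u)
  rw [inv_inv] at e
  rw [e, inner_averageRankOne, inner_averageRankOne,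
    ← integral_mul_left_eq_self (fun k => inner ℂ (σ.op k w) (σ.op h u) * _) h]
  refine integral_congr_ae (.of_forall fun k => ?_)
  simp only
  have e2 := σ.inner_op_inv h⁻¹ z (σ.op k v)
  rw [inv_inv] at e2
  rw [σ.op_mul, σ.op_mul, inner_op_op, e2]

theorem isSymmetric_averageRankOne [IsTopologicalGroup K] (v : V) :
    (σ.averageRankOne ν v v).toLinearMap.IsSymmetric := by
  intro u z
  change inner ℂ (σ.averageRankOne ν v v u) z = inner ℂ u (σ.averageRankOne ν v v z)
  rw [← inner_conj_symm, inner_averageRankOne, inner_averageRankOne, ← integral_conj]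
  refine integral_congr_ae (.of_forall fun k => ?_)
  simp [mul_comm]

theorem isCompactOperator_averageRankOne (v w : V) :
    IsCompactOperator (σ.averageRankOne ν v w) := by
  have h := Convex.integral_mem (μ := ν) (s := {T : V →L[ℂ] V | IsCompactOperator T})
    (f := fun k => rankOne ℂ (σ.op k v) (σ.op k w)) ?_ isClosed_setOfPred_isCompactOperator
    (.of_forall fun k => ?_) (σ.integrable_rankOne_op ν v w)
  · exact h
  · exact ((compactOperator (RingHom.id ℂ) V V).restrictScalars ℝ).convex
  · have h1 : IsCompactOperator (innerSL ℂ (σ.op k w)) :=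
      isCompactOperator_of_locallyCompactSpace_dom (innerSL ℂ (σ.op k w))
    exact h1.clm_comp (ContinuousLinearMap.toSpanSingleton ℂ (σ.op k v))

variable {σ}

/-- Eigenspaces of intertwiners are closed invariant subspaces. -/
theorem Irreducible.eigenspace_eq_bot_or_top (hσ : σ.Irreducible) (T : V →L[ℂ] V)
    (hT : ∀ k v, T (σ.op k v) = σ.op k (T v)) (c : ℂ) :
    Module.End.eigenspace T.toLinearMap c = ⊥ ∨ Module.End.eigenspace T.toLinearMap c = ⊤ := by
  refine hσ.2 _ ?_ fun k v hv => ?_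
  · have : (Module.End.eigenspace T.toLinearMap c : Set V) = {v | T v = c • v} := by
      ext v; simp
    rw [this]
    exact isClosed_eq T.continuous (continuous_const_smul c)
  · rw [Module.End.mem_eigenspace_iff] at hv ⊢
    change T (σ.op k v) = c • σ.op k v
    rw [hT, show T v = c • v from hv, map_smul]

theorem averageRankOne_self_ne_zero [ν.IsOpenPosMeasure] {v : V} (hv : v ≠ 0) :
    σ.averageRankOne ν v v ≠ 0 := by
  intro h0
  have h2 := σ.inner_averageRankOne ν v v v v
  have h3 : ∀ k, inner ℂ (σ.op k v) v * inner ℂ v (σ.op k v) =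
      ((‖inner ℂ (σ.op k v) v‖ ^ 2 : ℝ) : ℂ) := fun k => by
    rw [← inner_conj_symm v, Complex.mul_conj, Complex.normSq_eq_norm_sq]
  simp only [h0, zero_apply, inner_zero_right, h3] at h2
  rw [integral_complex_ofReal] at h2
  have hc : Continuous fun k => ‖inner ℂ (σ.op k v) v‖ ^ 2 :=
    ((σ.continuous_apply v).inner continuous_const).norm.pow 2
  refine (integral_pos_of_integrable_nonneg_nonzero (μ := ν) hc
    (hc.integrable_of_hasCompactSupport (.of_compactSpace _)) (fun k => sq_nonneg _)
    (x := 1) ?_).ne (by exact_mod_cast h2)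
  simp [op, hv]

/-- An irreducible unitary representation of a compact group is finite-dimensional: the average of
`|σ(k) v⟩⟨σ(k) v|` is a nonzero compact self-adjoint intertwiner, so it has a nonzero eigenvalue,
whose eigenspace is finite-dimensional, and is all of `V` by irreducibility. -/
theorem Irreducible.finiteDimensional [IsTopologicalGroup K] [ν.IsOpenPosMeasure]
    (hσ : σ.Irreducible) : FiniteDimensional ℂ V := by
  obtain ⟨v, hv⟩ := @exists_ne V hσ.1 0
  set T := σ.averageRankOne ν v v with hTdef
  have hc : IsCompactOperator T := σ.isCompactOperator_averageRankOne ν v v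
  have hT0 : T ≠ 0 := averageRankOne_self_ne_zero ν hv
  have h := mt (ContinuousLinearMap.eq_zero_of_forall_hasEigenvalue_eq_zero hc
    (σ.isSymmetric_averageRankOne ν v)).1 hT0
  push Not at h
  obtain ⟨c, hcT, hc0⟩ := h
  have hfin := ContinuousLinearMap.finite_dimensional_eigenspace hc c hc0
  rcases hσ.eigenspace_eq_bot_or_top T (fun k u => σ.averageRankOne_op ν v v u k) c with h | h
  · exact absurd h hcT
  · rw [h] at hfin
    exact Module.Finite.equiv (Submodule.topEquiv (R := ℂ) (M := V))

/-- Schur's lemma: the average of `|σ(k) v⟩⟨σ(k) w|` is the scalar `⟨w, v⟩ / dim V`. -/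
theorem Irreducible.averageRankOne_eq [IsTopologicalGroup K] [FiniteDimensional ℂ V]
    (hσ : σ.Irreducible) (v w u : V) :
    (Module.finrank ℂ V : ℂ) • σ.averageRankOne ν v w u = inner ℂ w v • u := by
  have := hσ.1
  set T := σ.averageRankOne ν v w with hTdef
  obtain ⟨c, hc⟩ := Module.End.exists_eigenvalue T.toLinearMap
  have htop : Module.End.eigenspace T.toLinearMap c = ⊤ :=
    (hσ.eigenspace_eq_bot_or_top T (fun k u => σ.averageRankOne_op ν v w u k) c).resolve_left hc
  have hT : ∀ u, T u = c • u := fun u => by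
    have : u ∈ Module.End.eigenspace T.toLinearMap c := by rw [htop]; trivial
    exact Module.End.mem_eigenspace_iff.1 this
  let b := stdOrthonormalBasis ℂ V
  -- The scalar is found by computing the trace of the average in two ways.
  have h1 : ∑ i, inner ℂ (b i) (T (b i)) = Module.finrank ℂ V * c := by
    simp [hT]
  have h2 : ∑ i, inner ℂ (b i) (T (b i)) = inner ℂ w v := by
    simp only [hTdef, inner_averageRankOne]
    rw [← integral_finsetSum]
    · simp only [b.sum_inner_mul_inner, inner_op_op]
      simp
    · intro i _
      exact (((σ.continuous_apply w).inner continuous_const).mul (continuous_const.inner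
        (σ.continuous_apply v))).integrable_of_hasCompactSupport (.of_compactSpace _)
  rw [hT, smul_smul, ← h1, h2]

/-- The reproducing property of the character, a form of the Schur orthogonality relations:
`∫ dim(V) Tr(σ(k)) σ(k⁻¹) v dk = v`. -/
theorem Irreducible.integral_trace_smul_op_inv [IsTopologicalGroup K] [FiniteDimensional ℂ V]
    (hσ : σ.Irreducible) (v : V) :
    ∫ k, ((Module.finrank ℂ V : ℂ) * LinearMap.trace ℂ V (σ.op k).toLinearMap) • σ.op k⁻¹ v ∂ν
      = v := by
  let b := stdOrthonormalBasis ℂ V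
  have hcont : ∀ u w : V, Continuous fun k => inner ℂ u (σ.op k w) := fun u w =>
    continuous_const.inner (σ.continuous_apply w)
  have hcont' : ∀ u w : V, Continuous fun k => inner ℂ (σ.op k w) u := fun u w =>
    (σ.continuous_apply w).inner continuous_const
  have htr : Continuous fun k => LinearMap.trace ℂ V (σ.op k).toLinearMap := by
    simp only [LinearMap.trace_eq_sum_inner _ b]
    exact continuous_finsetSum _ fun i _ => hcont _ _
  refine ext_inner_left ℂ fun w => ?_
  rw [← integral_inner]
  · simp only [inner_smul_right]
    -- After `k ↦ k⁻¹` the integrand is a sum of matrix coefficients of `averageRankOne`.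
    rw [← integral_comp_inv_of_compact]
    · have h1 : ∀ k : K, (Module.finrank ℂ V : ℂ) * LinearMap.trace ℂ V (σ.op k⁻¹).toLinearMap *
          inner ℂ w (σ.op k⁻¹⁻¹ v) = ∑ i, (Module.finrank ℂ V : ℂ) *
            (inner ℂ (σ.op k (b i)) (b i) * inner ℂ w (σ.op k v)) := fun k => by
        rw [LinearMap.trace_eq_sum_inner _ b, inv_inv, Finset.mul_sum, Finset.sum_mul]
        refine Finset.sum_congr rfl fun i _ => ?_
        rw [← σ.inner_op_inv, mul_assoc]
        rfl
      simp only [h1]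
      rw [integral_finsetSum]
      · simp only [integral_const_mul, ← inner_averageRankOne]
        simp only [← inner_smul_right, hσ.averageRankOne_eq ν]
        rw [← inner_sum, b.sum_repr']
      · intro i _
        exact (continuous_const.mul ((hcont' _ _).mul
          (hcont _ _))).integrable_of_hasCompactSupport (.of_compactSpace _)
    · exact (continuous_const.mul htr).mul ((hcont w v).comp continuous_inv)
  · exact ((continuous_const.mul htr).smul
      ((σ.continuous_apply v).comp continuous_inv)).integrable_of_hasCompactSupport
        (.of_compactSpace _)

end Schur
end UnitaryRep

/-! ### Operators on the Hilbert space tensor product -/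

section TensorOperators

open InnerProductSpace (rankOne)

variable {H : Type*} [NormedAddCommGroup H] [InnerProductSpace ℂ H]
  {V : Type*} [NormedAddCommGroup V] [InnerProductSpace ℂ V]

theorem HilbertTensor.clm_ext {E : Type*} [NormedAddCommGroup E] [NormedSpace ℂ E]
    {S T : HilbertTensor H V →L[ℂ] E}
    (h : ∀ (ξ : H) (v : V), S (incl (ξ ⊗ₜ[ℂ] v)) = T (incl (ξ ⊗ₜ[ℂ] v))) : S = T := by
  refine DFunLike.coe_injective (HilbertTensor.denseRange_incl.equalizer
    S.continuous T.continuous (funext fun x => ?_))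
  simp only [Function.comp_apply]
  induction x using TensorProduct.induction_on with
  | zero => simp
  | tmul ξ v => exact h ξ v
  | add x y hx hy => simp only [map_add, hx, hy]

theorem opTensor_incl_tmul (a : H →L[ℂ] H) (T : V →L[ℂ] V) (ξ : H) (v : V) :
    opTensor a T (HilbertTensor.incl (ξ ⊗ₜ[ℂ] v)) = HilbertTensor.incl (a ξ ⊗ₜ[ℂ] T v) :=
  opTensor_incl a T _

/-- The operator `ξ ↦ ξ ⊗ v` from `H` to `H ⊗ V`. Its adjoint pairs the second factor with `v`; for
an operator `p` on `H ⊗ V`, the operator `(tensorRight H v).adjoint ∘L p ∘L tensorRight H w` on `H`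
is the block `⟨v| p |w⟩`. -/
noncomputable def tensorRight (H : Type*) [NormedAddCommGroup H] [InnerProductSpace ℂ H] {V : Type*}
    [NormedAddCommGroup V] [InnerProductSpace ℂ V] (v : V) : H →L[ℂ] HilbertTensor H V :=
  HilbertTensor.incl.toContinuousLinearMap ∘L (TensorProduct.mkL ℂ H V).flip v

theorem tensorRight_apply (v : V) (ξ : H) :
    tensorRight H v ξ = HilbertTensor.incl (ξ ⊗ₜ[ℂ] v) := rfl

variable [CompleteSpace H]

theorem adjoint_tensorRight_incl (w : V) (ξ : H) (v : V) :
    (tensorRight H w).adjoint (HilbertTensor.incl (ξ ⊗ₜ[ℂ] v)) = (inner ℂ w v : ℂ) • ξ := by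
  refine ext_inner_left ℂ fun η => ?_
  rw [ContinuousLinearMap.adjoint_inner_right, tensorRight_apply, LinearIsometry.inner_map_map,
    TensorProduct.inner_tmul, inner_smul_right, mul_comm]

theorem tensorRight_comp_adjoint (v w : V) (c : H →L[ℂ] H) :
    tensorRight H v ∘L c ∘L (tensorRight H w).adjoint = opTensor c (rankOne ℂ v w) := by
  refine HilbertTensor.clm_ext fun ξ u => ?_
  rw [opTensor_incl_tmul]
  simp [adjoint_tensorRight_incl, tensorRight_apply, TensorProduct.tmul_smul]

theorem opTensor_comp_tensorRight (a : H →L[ℂ] H) (T : V →L[ℂ] V) (v : V) (c : H →L[ℂ] H) :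
    opTensor a T ∘L (tensorRight H v ∘L c) = tensorRight H (T v) ∘L (a ∘L c) := by
  ext ξ
  simp [tensorRight_apply, opTensor_incl_tmul]

/-- Expansion of `a ⊗ T` along an orthonormal basis of `V`. -/
theorem opTensor_eq_sum {ι : Type*} [Fintype ι] (b : OrthonormalBasis ι ℂ V) (a : H →L[ℂ] H)
    (T : V →L[ℂ] V) : opTensor a T =
      ∑ i, tensorRight H (T (b i)) ∘L a ∘L (tensorRight H (b i)).adjoint := by
  refine HilbertTensor.clm_ext fun ξ u => ?_
  simp only [sum_apply, tensorRight_comp_adjoint, opTensor_incl_tmul, ← map_sum,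
    ← TensorProduct.tmul_sum]
  simp only [InnerProductSpace.rankOne_apply, ← map_smul, ← map_sum, b.sum_repr']

theorem star_opTensor [CompleteSpace V] (a : H →L[ℂ] H) (T : V →L[ℂ] V) :
    star (opTensor a T) = opTensor (star a) (star T) := by
  refine HilbertTensor.clm_ext fun ξ u => ?_
  have h : innerSL ℂ (star (opTensor a T) (HilbertTensor.incl (ξ ⊗ₜ[ℂ] u))) =
      innerSL ℂ (opTensor (star a) (star T) (HilbertTensor.incl (ξ ⊗ₜ[ℂ] u))) := by
    refine HilbertTensor.clm_ext fun η w => ?_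
    simp only [innerSL_apply_apply, opTensor_incl_tmul, LinearIsometry.inner_map_map,
      ContinuousLinearMap.star_eq_adjoint, ContinuousLinearMap.adjoint_inner_left,
      TensorProduct.inner_tmul]
  exact (innerSL_inj (𝕜 := ℂ)).1 h

/-- `A ⊗ B(V)` is the closed linear span of the elementary tensors, as these are closed under
multiplication and the adjoint. -/
theorem coe_cstarTensorEnd [CompleteSpace V] (C : NonUnitalStarSubalgebra ℂ (H →L[ℂ] H)) :
    (cstarTensorEnd C V : Set (HilbertTensor H V →L[ℂ] HilbertTensor H V)) =
      ((Submodule.span ℂ {x | ∃ a ∈ C, ∃ T : V →L[ℂ] V, x = opTensor a T}).topologicalClosure :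
        Set (HilbertTensor H V →L[ℂ] HilbertTensor H V)) := by
  set G : Set (HilbertTensor H V →L[ℂ] HilbertTensor H V) :=
    {x | ∃ a ∈ C, ∃ T : V →L[ℂ] V, x = opTensor a T} with hG
  have hstar : star G ⊆ G := by
    rintro x ⟨a, ha, T, h⟩
    exact ⟨star a, star_mem ha, star T, by rw [← star_opTensor, ← h, star_star]⟩
  let S : Subsemigroup (HilbertTensor H V →L[ℂ] HilbertTensor H V) :=
    { carrier := G
      mul_mem' := by
        rintro _ _ ⟨a, ha, T, rfl⟩ ⟨b, hb, U, rfl⟩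
        exact ⟨a * b, mul_mem ha hb, T * U, (opTensor_mul a b T U).symm⟩ }
  have hS : (Subsemigroup.closure (G ∪ star G) : Set _) = G := by
    rw [Set.union_eq_left.2 hstar]
    exact congrArg SetLike.coe (Subsemigroup.closure_eq S)
  have h := NonUnitalStarAlgebra.adjoin_eq_span (R := ℂ) G
  rw [hS] at h
  rw [Submodule.topologicalClosure_coe, ← h]
  rfl

end TensorOperators

/-! ### The column module of a C⋆-algebra of operators -/

theorem Submodule.map_mem_of_mem_topologicalClosure_span {E F : Type*} [NormedAddCommGroup E]
    [NormedSpace ℂ E] [NormedAddCommGroup F] [NormedSpace ℂ F] {τ : ℂ →+* ℂ} (f : E →SL[τ] F)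
    {s : Set E} {P : Submodule ℂ F} (hP : IsClosed (P : Set F)) (h : ∀ x ∈ s, f x ∈ P) {x : E}
    (hx : x ∈ (Submodule.span ℂ s).topologicalClosure) : f x ∈ P :=
  Submodule.topologicalClosure_minimal (t := P.comap f.toLinearMap) _ (Submodule.span_le.2 h)
    (hP.preimage f.continuous) hx

section TensorModule

variable {H : Type*} [NormedAddCommGroup H] [InnerProductSpace ℂ H] [CompleteSpace H]
  (C : NonUnitalStarSubalgebra ℂ (H →L[ℂ] H))
  (V : Type*) [NormedAddCommGroup V] [InnerProductSpace ℂ V]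

/-- The column module `C ⊗ V`, realised as the closed linear span of the operators
`ξ ↦ c ξ ⊗ v` from `H` to `H ⊗ V`, with `c ∈ C` and `v ∈ V`. -/
noncomputable def columnModule : Submodule ℂ (H →L[ℂ] HilbertTensor H V) :=
  (Submodule.span ℂ {y | ∃ v : V, ∃ c ∈ C, y = tensorRight H v ∘L c}).topologicalClosure

theorem isClosed_columnModule :
    IsClosed (columnModule C V : Set (H →L[ℂ] HilbertTensor H V)) :=
  Submodule.isClosed_topologicalClosure _

variable {C V}

theorem tensorRight_comp_mem_columnModule (v : V) {c : H →L[ℂ] H} (hc : c ∈ C) :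
    tensorRight H v ∘L c ∈ columnModule C V :=
  Submodule.le_topologicalClosure _ (Submodule.subset_span ⟨v, c, hc, rfl⟩)

theorem map_mem_of_mem_columnModule {F : Type*} [NormedAddCommGroup F] [NormedSpace ℂ F]
    {τ : ℂ →+* ℂ} (f : (H →L[ℂ] HilbertTensor H V) →SL[τ] F) {P : Submodule ℂ F}
    (hP : IsClosed (P : Set F)) (h : ∀ v : V, ∀ c ∈ C, f (tensorRight H v ∘L c) ∈ P)
    {y : H →L[ℂ] HilbertTensor H V} (hy : y ∈ columnModule C V) : f y ∈ P :=
  Submodule.map_mem_of_mem_topologicalClosure_span f hP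
    (by rintro _ ⟨v, c, hc, rfl⟩; exact h v c hc) hy

theorem map_adjoint_mem_of_mem_columnModule {F : Type*} [NormedAddCommGroup F] [NormedSpace ℂ F]
    (f : (HilbertTensor H V →L[ℂ] H) →L[ℂ] F) {P : Submodule ℂ F}
    (hP : IsClosed (P : Set F)) (h : ∀ v : V, ∀ c ∈ C, f (tensorRight H v ∘L c).adjoint ∈ P)
    {y : H →L[ℂ] HilbertTensor H V} (hy : y ∈ columnModule C V) : f y.adjoint ∈ P :=
  map_mem_of_mem_columnModule (f.comp
    (ContinuousLinearMap.adjoint (𝕜 := ℂ) (E := H) (F := HilbertTensor H V)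
      ).toContinuousLinearEquiv.toContinuousLinearMap) hP h hy

theorem map_mem_of_mem_cstarTensorEnd [CompleteSpace V] {F : Type*} [NormedAddCommGroup F]
    [NormedSpace ℂ F] {τ : ℂ →+* ℂ}
    (f : (HilbertTensor H V →L[ℂ] HilbertTensor H V) →SL[τ] F) {P : Submodule ℂ F}
    (hP : IsClosed (P : Set F)) (h : ∀ c ∈ C, ∀ T : V →L[ℂ] V, f (opTensor c T) ∈ P)
    {a : HilbertTensor H V →L[ℂ] HilbertTensor H V} (ha : a ∈ cstarTensorEnd C V) : f a ∈ P := by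
  rw [← SetLike.mem_coe, coe_cstarTensorEnd] at ha
  exact Submodule.map_mem_of_mem_topologicalClosure_span f hP
    (by rintro _ ⟨c, hc, T, rfl⟩; exact h c hc T) ha

theorem opTensor_mem_cstarTensorEnd {c : H →L[ℂ] H} (hc : c ∈ C) (T : V →L[ℂ] V) :
    opTensor c T ∈ cstarTensorEnd C V :=
  NonUnitalStarSubalgebra.le_topologicalClosure _
    (NonUnitalStarAlgebra.subset_adjoin ℂ _ ⟨c, hc, T, rfl⟩)

theorem comp_mem_columnModule_left [CompleteSpace V]
    {a : HilbertTensor H V →L[ℂ] HilbertTensor H V}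
    (ha : a ∈ cstarTensorEnd C V) {y : H →L[ℂ] HilbertTensor H V} (hy : y ∈ columnModule C V) :
    a ∘L y ∈ columnModule C V := by
  refine map_mem_of_mem_cstarTensorEnd ((ContinuousLinearMap.compL ℂ H _ _).flip y)
    (isClosed_columnModule C V) (fun c hc T => ?_) ha
  refine map_mem_of_mem_columnModule (ContinuousLinearMap.compL ℂ H _ _ (opTensor c T))
    (isClosed_columnModule C V) (fun v d hd => ?_) hy
  rw [ContinuousLinearMap.compL_apply, opTensor_comp_tensorRight]
  exact tensorRight_comp_mem_columnModule _ (mul_mem hc hd)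

theorem comp_mem_columnModule_right {b : H →L[ℂ] H} (hb : b ∈ C)
    {y : H →L[ℂ] HilbertTensor H V} (hy : y ∈ columnModule C V) : y ∘L b ∈ columnModule C V := by
  have h : ∀ v : V, ∀ d ∈ C, (tensorRight H v ∘L d) ∘L b ∈ columnModule C V := fun v d hd => by
    rw [ContinuousLinearMap.comp_assoc]
    exact tensorRight_comp_mem_columnModule v (mul_mem hd hb)
  exact map_mem_of_mem_columnModule
    ((ContinuousLinearMap.compL ℂ H H (HilbertTensor H V)).flip b) (isClosed_columnModule C V) h hy

theorem comp_adjoint_mem_cstarTensorEnd {x y : H →L[ℂ] HilbertTensor H V}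
    (hx : x ∈ columnModule C V) (hy : y ∈ columnModule C V) :
    x ∘L y.adjoint ∈ cstarTensorEnd C V := by
  have hcl : IsClosed ((cstarTensorEnd C V).toSubmodule :
    Set (HilbertTensor H V →L[ℂ] HilbertTensor H V)) := cstarTensorEnd.isClosed C
  have hgen : ∀ (v w : V), ∀ c ∈ C, ∀ d ∈ C,
      (tensorRight H v ∘L c) ∘L (tensorRight H w ∘L d).adjoint ∈ cstarTensorEnd C V := by
    intro v w c hc d hd
    have h : (tensorRight H v ∘L c) ∘L (tensorRight H w ∘L d).adjoint =
        opTensor (c * star d) (InnerProductSpace.rankOne ℂ v w) := by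
      rw [← tensorRight_comp_adjoint, ContinuousLinearMap.adjoint_comp]
      rfl
    rw [h]
    exact opTensor_mem_cstarTensorEnd (mul_mem hc (star_mem hd)) _
  have h1 : ∀ (v : V), ∀ c ∈ C, (tensorRight H v ∘L c) ∘L y.adjoint ∈ cstarTensorEnd C V :=
    fun v c hc => map_adjoint_mem_of_mem_columnModule (P := (cstarTensorEnd C V).toSubmodule)
      (ContinuousLinearMap.compL ℂ (HilbertTensor H V) H (HilbertTensor H V)
        (tensorRight H v ∘L c)) hcl (fun w d hd => hgen v w c hc d hd) hy
  exact map_mem_of_mem_columnModule (P := (cstarTensorEnd C V).toSubmodule)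
    ((ContinuousLinearMap.compL ℂ (HilbertTensor H V) H (HilbertTensor H V)).flip y.adjoint) hcl
    h1 hx

end TensorModule

/-! ### Morita-Rieffel equivalence of a corner and an ideal -/

section Corner

theorem closedIdeal_le {B : Type*} [NonUnitalCStarAlgebra B] (A : NonUnitalStarSubalgebra ℂ B)
    [hA : IsClosed (A : Set B)] (q : B) (hqA : q ∈ A) (hq : IsSelfAdjoint q) :
    closedIdeal A q hqA hq ≤ A := by
  intro x hx
  rw [← SetLike.mem_coe, coe_closedIdeal] at hx
  have h : Submodule.span ℂ {x | ∃ a ∈ A, ∃ b ∈ A, x = a * q * b} ≤ A.toSubmodule :=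
    Submodule.span_le.2 (by
      rintro _ ⟨a, ha, b, hb, rfl⟩
      exact show a * q * b ∈ A from mul_mem (mul_mem ha hqA) hb)
  exact closure_minimal h hA hx

variable {H : Type u} [NormedAddCommGroup H] [InnerProductSpace ℂ H] [CompleteSpace H]
  (C : NonUnitalStarSubalgebra ℂ (H →L[ℂ] H))
  {V : Type v} [NormedAddCommGroup V] [InnerProductSpace ℂ V] [FiniteDimensional ℂ V]
  {p : HilbertTensor H V →L[ℂ] HilbertTensor H V} (hp : IsStarProjection p)
  {q : H →L[ℂ] H} (hqC : q ∈ C) (hq : IsSelfAdjoint q)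

/-- An operator on `H ⊗ V` all of whose blocks `⟨v| p |w⟩` lie in `C` belongs to `C ⊗ B(V)`. -/
theorem mem_cstarTensorEnd_of_blocks_mem
    (hpC : ∀ v w : V, (tensorRight H v).adjoint ∘L p ∘L tensorRight H w ∈ C) :
    p ∈ cstarTensorEnd C V := by
  set b := stdOrthonormalBasis ℂ V
  have h1 : (1 : HilbertTensor H V →L[ℂ] HilbertTensor H V) =
      ∑ i, tensorRight H (b i) ∘L (tensorRight H (b i)).adjoint := by
    rw [← opTensor_one, opTensor_eq_sum b]
    rfl
  have h2 : p = ∑ i, ∑ j, opTensor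
      ((tensorRight H (b i)).adjoint ∘L p ∘L tensorRight H (b j))
      (InnerProductSpace.rankOne ℂ (b i) (b j)) := by
    calc p = 1 * p * 1 := by simp
      _ = _ := by
        rw [h1, Finset.sum_mul, Finset.sum_mul]
        refine Finset.sum_congr rfl fun i _ => ?_
        rw [Finset.mul_sum]
        refine Finset.sum_congr rfl fun j _ => ?_
        rw [← tensorRight_comp_adjoint]
        rfl
  rw [h2]
  exact sum_mem fun i _ => sum_mem fun j _ => opTensor_mem_cstarTensorEnd (hpC _ _) _

/-- The right inner products take values in the ideal, since `⟨v| p |w⟩ = ⟨v| p |w⟩ q`. -/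
theorem adjoint_comp_comp_mem_closedIdeal
    (hpC : ∀ v w : V, (tensorRight H v).adjoint ∘L p ∘L tensorRight H w ∈ C)
    (hpq : ∀ v : V, p ∘L tensorRight H v ∘L q = p ∘L tensorRight H v)
    {x y : H →L[ℂ] HilbertTensor H V} (hx : x ∈ columnModule C V) (hy : y ∈ columnModule C V) :
    x.adjoint ∘L (p ∘L y) ∈ closedIdeal C q hqC hq := by
  have hcl : IsClosed ((closedIdeal C q hqC hq).toSubmodule : Set (H →L[ℂ] H)) :=
    closedIdeal.isClosed C q hqC hq
  have hgen : ∀ (v w : V), ∀ c ∈ C, ∀ d ∈ C,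
      (tensorRight H v ∘L c).adjoint ∘L (p ∘L (tensorRight H w ∘L d)) ∈
        closedIdeal C q hqC hq := by
    intro v w c hc d hd
    have h' : (tensorRight H v).adjoint ∘L p ∘L tensorRight H w =
        ((tensorRight H v).adjoint ∘L p ∘L tensorRight H w) ∘L q := by
      conv_lhs => rw [← hpq]
      rfl
    have h : (tensorRight H v ∘L c).adjoint ∘L (p ∘L (tensorRight H w ∘L d)) =
        (star c * ((tensorRight H v).adjoint ∘L p ∘L tensorRight H w)) * q * d := by
      rw [ContinuousLinearMap.adjoint_comp]
      change star c * ((tensorRight H v).adjoint ∘L p ∘L tensorRight H w) * d = _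
      conv_lhs => rw [h']
      rfl
    rw [h, ← SetLike.mem_coe, coe_closedIdeal]
    exact subset_closure (Submodule.subset_span
      ⟨_, mul_mem (star_mem hc) (hpC v w), d, hd, rfl⟩)
  have h1 : ∀ (w : V), ∀ d ∈ C, x.adjoint ∘L (p ∘L (tensorRight H w ∘L d)) ∈
      closedIdeal C q hqC hq :=
    fun w d hd => map_adjoint_mem_of_mem_columnModule (P := (closedIdeal C q hqC hq).toSubmodule)
      ((ContinuousLinearMap.compL ℂ H (HilbertTensor H V) H).flip (p ∘L (tensorRight H w ∘L d)))
      hcl (fun v c hc => hgen v w c hc d hd) hx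
  exact map_mem_of_mem_columnModule (P := (closedIdeal C q hqC hq).toSubmodule)
    ((ContinuousLinearMap.compL ℂ H (HilbertTensor H V) H x.adjoint).comp
      (ContinuousLinearMap.compL ℂ H (HilbertTensor H V) (HilbertTensor H V) p)) hcl h1 hy

/-- The left inner products of generators span a dense subspace of the corner. -/
theorem comp_comp_mem_of_generators_mem [IsClosed (C : Set (H →L[ℂ] H))]
    (hpstar : p.adjoint = p)
    {P : Submodule ℂ (HilbertTensor H V →L[ℂ] HilbertTensor H V)}
    (hP : IsClosed (P : Set (HilbertTensor H V →L[ℂ] HilbertTensor H V)))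
    (h : ∀ (v w : V), ∀ c ∈ C, ∀ d ∈ C,
      (p ∘L (tensorRight H v ∘L c)) ∘L (p ∘L (tensorRight H w ∘L d)).adjoint ∈ P)
    {a : HilbertTensor H V →L[ℂ] HilbertTensor H V} (ha : a ∈ cstarTensorEnd C V) :
    p ∘L a ∘L p ∈ P := by
  have : CompleteSpace V := FiniteDimensional.complete ℂ V
  let f : (HilbertTensor H V →L[ℂ] HilbertTensor H V) →L[ℂ]
      (HilbertTensor H V →L[ℂ] HilbertTensor H V) :=
    (ContinuousLinearMap.compL ℂ _ _ _ p).comp ((ContinuousLinearMap.compL ℂ _ _ _).flip p)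
  have hf : ∀ a, f a = p ∘L a ∘L p := fun a => rfl
  have hblock : ∀ v w : V, ∀ c ∈ C,
      f (tensorRight H v ∘L c ∘L (tensorRight H w).adjoint) ∈ P := by
    intro v w c hc
    let g : (H →L[ℂ] H) → (HilbertTensor H V →L[ℂ] HilbertTensor H V) := fun c =>
      f (tensorRight H v ∘L c ∘L (tensorRight H w).adjoint)
    have hg : Continuous g := by fun_prop
    refine closure_minimal (t := g ⁻¹' (P : Set _)) ?_ (hP.preimage hg)
      (C.mem_closure_mul_star hc)
    rintro _ ⟨d, hd, e, he, rfl⟩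
    have h1 := h v w d hd e he
    rw [ContinuousLinearMap.adjoint_comp, ContinuousLinearMap.adjoint_comp, hpstar] at h1
    exact h1
  rw [← hf]
  refine map_mem_of_mem_cstarTensorEnd f hP (fun c hc T => ?_) ha
  rw [opTensor_eq_sum (stdOrthonormalBasis ℂ V), map_sum]
  exact sum_mem fun i _ => hblock _ _ c hc

/-- Let `p` be a projection on `H ⊗ V` whose blocks `⟨v| p |w⟩` lie in `C`, and let `q ∈ C` be a
linear combination of blocks with `p (q ⊗ 1) (ξ ⊗ v) = p (ξ ⊗ v)`. Then the space `p (C ⊗ V)` is an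
imprimitivity bimodule between `p (C ⊗ B(V)) p` and the ideal of `C` generated by `q`. -/
theorem moritaRieffelEquivalent_corner_closedIdeal [IsClosed (C : Set (H →L[ℂ] H))]
    (hpC : ∀ v w : V, (tensorRight H v).adjoint ∘L p ∘L tensorRight H w ∈ C)
    (hpq : ∀ v : V, p ∘L tensorRight H v ∘L q = p ∘L tensorRight H v)
    (hqp : q ∈ Submodule.span ℂ
      {x | ∃ v w : V, x = (tensorRight H v).adjoint ∘L p ∘L tensorRight H w}) :
    MoritaRieffelEquivalent (corner (cstarTensorEnd C V) p hp) (closedIdeal C q hqC hq) := by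
  have hpA : p ∈ cstarTensorEnd C V := mem_cstarTensorEnd_of_blocks_mem C hpC
  have hpp : p ∘L p = p := hp.isIdempotentElem
  have hpstar : p.adjoint = p := hp.isSelfAdjoint
  have : CompleteSpace V := FiniteDimensional.complete ℂ V
  -- As `p ∈ C ⊗ B(V)`, the space `p (C ⊗ V)` consists of the `x ∈ C ⊗ V` with `p x = x`.
  let X : Submodule ℂ (H →L[ℂ] HilbertTensor H V) :=
    columnModule C V ⊓ LinearMap.eqLocus (ContinuousLinearMap.compL ℂ H _ _ p).toLinearMap
      LinearMap.id
  have hXcl : IsClosed (X : Set (H →L[ℂ] HilbertTensor H V)) :=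
    (isClosed_columnModule C V).inter
      (isClosed_eq (ContinuousLinearMap.compL ℂ H _ _ p).continuous continuous_id)
  have hXc : CompleteSpace X := hXcl.completeSpace_coe
  have hpX : ∀ y ∈ columnModule C V, p ∘L y ∈ X := fun y hy =>
    ⟨comp_mem_columnModule_left hpA hy, by
      change p ∘L p ∘L y = p ∘L y
      rw [← ContinuousLinearMap.comp_assoc, hpp]⟩
  have hgen : ∀ (v : V), ∀ c ∈ C, p ∘L (tensorRight H v ∘L c) ∈ X := fun v c hc =>
    hpX _ (tensorRight_comp_mem_columnModule v hc)
  refine ⟨X, inferInstance, inferInstance, hXc, ⟨ternaryBimodule _ _ X ?_ ?_ ?_ ?_ ?_ ?_⟩⟩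
  · rintro a ⟨ha, hpa, -⟩ x ⟨hx, -⟩
    refine ⟨comp_mem_columnModule_left ha hx, ?_⟩
    change (p * a) ∘L x = a ∘L x
    rw [hpa]
  · rintro b hb x ⟨hx, hpx⟩
    exact ⟨comp_mem_columnModule_right (closedIdeal_le C q hqC hq hb) hx,
      congrArg (· ∘L b) hpx⟩
  · rintro x ⟨hx, hpx⟩ y ⟨hy, hpy⟩
    refine ⟨comp_adjoint_mem_cstarTensorEnd hx hy, congrArg (· ∘L y.adjoint) hpx, ?_⟩
    change x ∘L (y.adjoint ∘L p) = _
    conv_lhs => rw [← hpstar, ← ContinuousLinearMap.adjoint_comp]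
    exact congrArg (fun z => x ∘L ContinuousLinearMap.adjoint z) hpy
  · rintro x ⟨hx, -⟩ y ⟨hy, hpy⟩
    have h := adjoint_comp_comp_mem_closedIdeal C hqC hq hpC hpq hx hy
    rwa [show p ∘L y = y from hpy] at h
  · rintro a ⟨ha, hpa, hap⟩
    rw [← Submodule.topologicalClosure_coe, SetLike.mem_coe]
    have h := comp_comp_mem_of_generators_mem C hpstar
      (P := (Submodule.span ℂ {a | ∃ x ∈ X, ∃ y ∈ X, a = x ∘L y.adjoint}).topologicalClosure)
      (Submodule.isClosed_topologicalClosure _) (fun v w c hc d hd =>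
        Submodule.le_topologicalClosure _ (Submodule.subset_span
          ⟨_, hgen v c hc, _, hgen w d hd, rfl⟩)) ha
    rwa [show a ∘L p = a from hap, show p ∘L a = a from hpa] at h
  · intro b hb
    rw [coe_closedIdeal] at hb
    refine closure_mono (Submodule.span_le.2 ?_) hb
    rintro _ ⟨a, ha, d, hd, rfl⟩
    have hle : Submodule.span ℂ
        {x | ∃ v w : V, x = (tensorRight H v).adjoint ∘L p ∘L tensorRight H w} ≤
        (Submodule.span ℂ {b | ∃ x ∈ X, ∃ y ∈ X, b = x.adjoint ∘L y}).comap
          (LinearMap.mulLeftRight ℂ (a, d)) := by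
      refine Submodule.span_le.2 ?_
      rintro _ ⟨v, w, rfl⟩
      refine Submodule.subset_span
        ⟨_, hgen v (star a) (star_mem ha), _, hgen w d hd, ?_⟩
      rw [ContinuousLinearMap.adjoint_comp, ContinuousLinearMap.adjoint_comp, hpstar,
        ← ContinuousLinearMap.star_eq_adjoint, star_star]
      change a * ((tensorRight H v).adjoint ∘L p ∘L tensorRight H w) * d =
        a * ((tensorRight H v).adjoint ∘L (p ∘L p) ∘L tensorRight H w) * d
      rw [hpp]
    exact hle hqp

end Corner

/-! ### Tensor products with an irreducible representation of a compact group -/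

namespace UnitaryRep

section Average

variable {K : Type*} [Group K] [TopologicalSpace K] [IsTopologicalGroup K] [CompactSpace K]
  [MeasurableSpace K] [BorelSpace K] (ν : Measure K) [ν.IsMulLeftInvariant]
  [IsProbabilityMeasure ν]
  {H : Type*} [NormedAddCommGroup H] [InnerProductSpace ℂ H] [CompleteSpace H]
  (π : UnitaryRep K H)
  {V : Type*} [NormedAddCommGroup V] [InnerProductSpace ℂ V] [CompleteSpace V]
  (σ : UnitaryRep K V)

/-- The matrix coefficient `k ↦ ⟨v, σ(k) w⟩`. -/
noncomputable def matrixCoeff (v w : V) : C(K, ℂ) where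
  toFun k := inner ℂ v (σ.op k w)
  continuous_toFun := continuous_const.inner (σ.continuous_apply w)

theorem tensor_op_incl_tmul (k : K) (ξ : H) (v : V) :
    (π.tensor σ).op k (HilbertTensor.incl (ξ ⊗ₜ[ℂ] v)) =
      HilbertTensor.incl (π.op k ξ ⊗ₜ[ℂ] σ.op k v) :=
  unitaryTensor_tmul _ _ _ _

theorem integrated_compactOne_apply (ξ : H) :
    π.integrated ν (compactOne K) ξ = ∫ k, π.op k ξ ∂ν := by
  simp [integrated_apply, compactOne]

theorem integrable_op (ξ : H) : Integrable (fun k => π.op k ξ) ν :=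
  (π.continuous_apply ξ).integrable_of_hasCompactSupport (.of_compactSpace _)

theorem op_average (h : K) (ξ : H) :
    π.op h (π.integrated ν (compactOne K) ξ) = π.integrated ν (compactOne K) ξ := by
  rw [integrated_compactOne_apply, ← ContinuousLinearMap.integral_comp_comm _
    (π.integrable_op ν ξ), ← integral_mul_left_eq_self (fun k => π.op k ξ) h]
  simp only [op_mul]

/-- The average absorbs group elements on the right. Left invariance of the measure gives this for
products on the left; the two are exchanged by self-adjointness of the average. -/
theorem average_op (h : K) (ξ : H) :
    π.integrated ν (compactOne K) (π.op h ξ) = π.integrated ν (compactOne K) ξ := by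
  have hs := π.isSelfAdjoint_integrated ν (compactOne K) fun _ => star_one ℂ
  rw [ContinuousLinearMap.isSelfAdjoint_iff_isSymmetric] at hs
  refine ext_inner_left ℂ fun η => ?_
  have h1 := hs η (π.op h ξ)
  have h2 := hs η ξ
  simp only [ContinuousLinearMap.coe_coe] at h1 h2
  rw [← h1, ← h2]
  conv_lhs => rw [← π.op_average ν h η, inner_op_op]

/-- The blocks `⟨v| p |w⟩` of the average `p` of `π ⊗ σ` are the integrals of the matrix
coefficients of `σ` against `π`. -/
theorem adjoint_tensorRight_comp_average_comp_tensorRight (v w : V) :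
    (tensorRight H v).adjoint ∘L (π.tensor σ).integrated ν (compactOne K) ∘L tensorRight H w =
      π.integrated ν (CompactlySupportedContinuousMap.continuousMapEquiv (σ.matrixCoeff v w)) := by
  ext ξ
  change (tensorRight H v).adjoint ((π.tensor σ).integrated ν (compactOne K)
    (tensorRight H w ξ)) = _
  rw [integrated_compactOne_apply, ← ContinuousLinearMap.integral_comp_comm _
    ((π.tensor σ).integrable_op ν _), integrated_apply]
  simp only [tensorRight_apply, tensor_op_incl_tmul, adjoint_tensorRight_incl]
  rfl

/-- The average `p` of `π ⊗ σ` absorbs the integrated character: `p (ψ ξ ⊗ v) = p (ξ ⊗ v)`. Indeed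
`p (π(k) ξ ⊗ v) = p (ξ ⊗ σ(k⁻¹) v)`, which moves the character from `π` to the finite-dimensional
factor, where its reproducing property applies. -/
theorem average_comp_tensorRight_comp_integrated [ν.IsOpenPosMeasure] (hσ : σ.Irreducible)
    (f : C_c(K, ℂ)) (hf : ∀ k, f k =
      (Module.finrank ℂ V : ℂ) * LinearMap.trace ℂ V (σ.op k).toLinearMap) (v : V) :
    (π.tensor σ).integrated ν (compactOne K) ∘L tensorRight H v ∘L π.integrated ν f =
      (π.tensor σ).integrated ν (compactOne K) ∘L tensorRight H v := by
  have := hσ.finiteDimensional ν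
  ext ξ
  set p := (π.tensor σ).integrated ν (compactOne K)
  change p (tensorRight H v (π.integrated ν f ξ)) = p (tensorRight H v ξ)
  have h1 : ∀ k, p (tensorRight H v (π.op k ξ)) =
      p (HilbertTensor.incl (ξ ⊗ₜ[ℂ] σ.op k⁻¹ v)) := fun k => by
    rw [← (π.tensor σ).average_op ν k (HilbertTensor.incl (ξ ⊗ₜ[ℂ] σ.op k⁻¹ v)),
      tensor_op_incl_tmul, ← op_mul, mul_inv_cancel, tensorRight_apply]
    simp [op, p]
  let T : V →L[ℂ] HilbertTensor H V :=
    p ∘L HilbertTensor.incl.toContinuousLinearMap ∘L TensorProduct.mkL ℂ H V ξ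
  have hT : ∀ u, T u = p (HilbertTensor.incl (ξ ⊗ₜ[ℂ] u)) := fun u => rfl
  have hint : Integrable (fun k => f k • σ.op k⁻¹ v) ν :=
    ((map_continuous f).smul ((σ.continuous_apply v).comp
      continuous_inv)).integrable_of_hasCompactSupport (.of_compactSpace _)
  calc p (tensorRight H v (π.integrated ν f ξ))
      = ∫ k, (p ∘L tensorRight H v) (f k • π.op k ξ) ∂ν := by
        rw [ContinuousLinearMap.integral_comp_comm _ (π.integrable_smul ν f ξ)]
        rfl
    _ = ∫ k, T (f k • σ.op k⁻¹ v) ∂ν := by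
        refine integral_congr_ae (.of_forall fun k => ?_)
        simp only
        rw [map_smul, map_smul, ContinuousLinearMap.comp_apply, h1, hT]
    _ = T (∫ k, f k • σ.op k⁻¹ v ∂ν) := T.integral_comp_comm hint
    _ = p (tensorRight H v ξ) := by
        simp only [hf, hσ.integral_trace_smul_op_inv ν v]
        rfl

/-- The integrated character is `dim V` times the sum of the diagonal blocks of the average of
`π ⊗ σ`. -/
theorem integrated_eq_sum_blocks [FiniteDimensional ℂ V]
    (f : C_c(K, ℂ)) (hf : ∀ k, f k =
      (Module.finrank ℂ V : ℂ) * LinearMap.trace ℂ V (σ.op k).toLinearMap) :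
    π.integrated ν f = ∑ i, (Module.finrank ℂ V : ℂ) •
      ((tensorRight H (stdOrthonormalBasis ℂ V i)).adjoint ∘L
        (π.tensor σ).integrated ν (compactOne K) ∘L
          tensorRight H (stdOrthonormalBasis ℂ V i)) := by
  ext ξ
  simp only [adjoint_tensorRight_comp_average_comp_tensorRight, sum_apply, smul_apply,
    integrated_apply]
  simp only [← integral_smul]
  rw [← integral_finsetSum]
  · refine integral_congr_ae (.of_forall fun k => ?_)
    simp only
    rw [hf, LinearMap.trace_eq_sum_inner _ (stdOrthonormalBasis ℂ V), Finset.mul_sum,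
      Finset.sum_smul]
    refine Finset.sum_congr rfl fun i _ => ?_
    rw [mul_smul]
    rfl
  · intro i _
    exact (π.integrable_smul ν _ ξ).smul _

end Average
end UnitaryRep

/-! ### The Hecke algebra and the ideal of the character projection -/

theorem theorem5p1 {L : Type u} [Group L] [TopologicalSpace L] [IsTopologicalGroup L]
    [T2Space L] [LocallyCompactSpace L] [MeasurableSpace L] [BorelSpace L]
    (M : OpenSubgroup L) [CompactSpace M]
    (μ : Measure L) [μ.IsHaarMeasure] (hμ : μ (M : Set L) = 1)
    {V : Type v} [NormedAddCommGroup V] [InnerProductSpace ℂ V] [CompleteSpace V]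
    (σ : UnitaryRep M V) (hσ : σ.Irreducible) :
    MoritaRieffelEquivalent (heckeCStarAlgebra μ σ hμ) (characterIdeal μ σ hμ) := by
  have := isProbabilityMeasure_subgroupHaar μ M hμ
  have := hσ.finiteDimensional (subgroupHaar μ M)
  have hcl : IsClosed (groupCStarAlgebra L μ : Set (UniversalSpace L →L[ℂ] UniversalSpace L)) :=
    NonUnitalStarSubalgebra.isClosed_topologicalClosure _
  have hψ := integrated_extendByZero μ (universalRep L) (scaledCharacter σ)
  refine moritaRieffelEquivalent_corner_closedIdeal (groupCStarAlgebra L μ)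
    (isStarProjection_heckeProjection μ σ hμ) (integrated_mem_groupCStarAlgebra μ _)
    (isSelfAdjoint_characterProjection μ σ hμ) (fun v w => ?_) (fun v => ?_) ?_
  · rw [heckeProjection, UnitaryRep.adjoint_tensorRight_comp_average_comp_tensorRight,
      ← integrated_extendByZero]
    exact integrated_mem_groupCStarAlgebra μ _
  · rw [hψ]
    exact UnitaryRep.average_comp_tensorRight_comp_integrated _ _ σ hσ _ (fun k => rfl) v
  · rw [hψ, UnitaryRep.integrated_eq_sum_blocks _ _ σ _ (fun k => rfl)]
    exact Submodule.sum_mem _ fun i _ => Submodule.smul_mem _ _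
      (Submodule.subset_span ⟨_, _, rfl⟩)
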